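/- **Theorem (sectored real lemma for semi-stable systems).** *Phases of a matrix.* For $C\in\mathbb C^{m\times m}$ let $W'(C)=\{x^*Cx: x\neq 0\}$; the field angle $\delta(C)$ is $2\pi$ if $W'(C)=\mathbb C$, $\pi$ if $W'(C)$ contains exactly one line through $0$, and the angle subtended by $W'(C)$ otherwise. $C$ is semi-sectorial if $\delta(C)\le\pi$. Such a $C$ can be written $C=T^*\,\mathrm{diag}(0,D,E)\,T$ with $T$ nonsingular, $D=\mathrm{diag}(e^{j\theta_1},\dots,e^{j\theta_p})$, $|\theta_i-\theta_0|\le\pi/2$, and $E$ consisting of $q\ge 0$ diagonal blocks $e^{j\theta_0}\begin{bmatrix}1&2\\0&1\end{bmatrix}$. Its phases are $\theta_1,\dots,\theta_p$ and $q$ copies each of $\theta_0\pm\pi/2$; $\overline\phi(C)$ and $\underline\phi(C)$ are the largest and the smallest phase ($-\infty$ and $+\infty$ if $C=0$), and $\gamma(C)=(\overline\phi(C)+\underline\phi(C))/2$ is the phase center. The phases of $C\ne0$ are unique once $\gamma(C)$ is selected. *Systems.* Let $G$ be an $m\times m$ real rational proper transfer matrix that is semi-stable (no poles in $\mathrm{Re}\,s>0$),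 and let $j\Omega$ be its set of poles on the imaginary axis. $G$ is frequency-wise semi-sectorial if $G(j\omega)$ is semi-sectorial for all $\omega\in[-\infty,\infty]\setminus\Omega$ and, for all sufficiently small $\epsilon>0$, $G(s)$ is semi-sectorial and of constant rank along the imaginary axis indented into the right half plane by half circles of radius $\epsilon$ around the poles and finite zeros of $G$ on the axis, and by a half circle of radius $1/\epsilon$ if infinity is a zero. (A zero is a point where the rank of $G$ is below its normal rank.) The phases of $G(s)$ are selected so that $\gamma(G(s))$ is continuous along the upper half of the indented axis, with $\gamma(G(0))=0$, or $\gamma(G(\epsilon))=0$ if $0$ is a pole or a zero of $G$; at a zero on the axis or at infinity they are selected to agree with the phases at nearby frequencies. Put $\overline\phi(G)=\sup_{\omega\in[0,\infty]\setminus\Omega}\overline\phi(G(j\omega))$, $\underline\phi(G)=\inf_{\omega\in[0,\infty]\setminus\Omega}\underline\phi(G(j\omega))$ and $\Phi_\infty(G)=[\underline\phi(G),\overline\phi(G)]$. $G$ is semi-sectorial if it is frequency-wise semi-sectorial, with such a selection of phases, and $\Phi_\infty(G)$ is contained in an interval of length at most $\pi$. Since phases are determined modulo $2\pi$, we write $\Phi_\infty(G)\subset[\alpha,\beta]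 \pmod{2\pi}$ if $\Phi_\infty(G)\subset[\alpha+2k\pi,\beta+2k\pi]$ for some $k\in\mathbb Z$. *Statement.* Let $G$ be semi-stable and semi-sectorial with a minimal (least order) real realization $G(s)=C(sI-A)^{-1}B+D$. Let $\alpha,\beta\in\mathbb R$ with $\beta-\alpha\le\pi$, $\eta_1=\alpha+\frac\pi2$, $\eta_2=\beta-\frac\pi2$. Consider the condition (LMI) there exist Hermitian matrices $X_i,Y_i$, $i=1,2$, such that $$Y_i\ge0,\qquad \begin{bmatrix}A&B\\I&0\end{bmatrix}'\begin{bmatrix}0&X_i+jY_i\\X_i-jY_i&0\end{bmatrix}\begin{bmatrix}A&B\\I&0\end{bmatrix}+M_i\le0,\qquad M_i=\begin{bmatrix}0&-e^{j\eta_i}C'\\-e^{-j\eta_i}C&-e^{-j\eta_i}D-e^{j\eta_i}D'\end{bmatrix}.$$ 1. Suppose $\alpha<\beta$ and exclude the degenerate case in which simultaneously $\beta=\alpha+\pi$, $e^{-j\alpha}G(j\omega)$ is Hermitian for all $\omega\in[0,\infty]\setminus\Omega$, and $\Phi_\infty(G)=[\alpha+\pi+2k\pi,\alpha+2\pi+2k\pi]$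 for some $k\in\mathbb Z$. Then $\Phi_\infty(G)\subset[\alpha,\beta]\pmod{2\pi}$ if and only if (LMI) holds. 2. Without the two restrictions in 1, $\Phi_\infty(G)\subset[\alpha,\beta]\pmod{2\pi}$ still implies (LMI). 3. If $\alpha=-\frac\pi2$ and $\beta=\frac\pi2$, then (LMI) reduces to the single linear matrix inequality of the positive real lemma: (LMI) holds if and only if there is a real symmetric $X$ with $$\begin{bmatrix}A'X+XA&XB-C'\\B'X-C&-D-D'\end{bmatrix}\le0.$$ -/

import Mathlib

open scoped ComplexOrder

noncomputable section

/-! ### Phases of a complex matrix -/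

/-- The angular numerical range `W'(C) = {x^* C x : x ≠ 0}`. -/
def angularNumericalRange {m : ℕ} (C : Matrix (Fin m) (Fin m) ℂ) : Set ℂ :=
  {w | ∃ x : Fin m → ℂ, x ≠ 0 ∧ w = star x ⬝ᵥ (C.mulVec x)}

open Classical in
/-- The field angle `δ(C)`: it is `2π` if `W'(C)` is the whole plane, `π` if `W'(C)` contains
one line through the origin, and otherwise the angle subtended by the salient cone `W'(C)`. -/
def fieldAngle {m : ℕ} (C : Matrix (Fin m) (Fin m) ℂ) : ℝ :=
  if angularNumericalRange C = Set.univ then 2 * Real.pi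
  else if ∃ z : ℂ, z ≠ 0 ∧ ∀ t : ℝ, (t : ℂ) * z ∈ angularNumericalRange C then Real.pi
  else sSup {a : ℝ | ∃ z ∈ angularNumericalRange C, ∃ w ∈ angularNumericalRange C,
    z ≠ 0 ∧ w ≠ 0 ∧ a = InnerProductGeometry.angle z w}

/-- A square complex matrix is semi-sectorial if its field angle is at most `π`. -/
def IsSemiSectorial {m : ℕ} (C : Matrix (Fin m) (Fin m) ℂ) : Prop :=
  fieldAngle C ≤ Real.pi

/-- The block diagonal matrix `diag(0, D, E)` of the generalized sectorial decomposition, where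
`D = diag(e^{jθ₁}, …, e^{jθ_p})` and `E` consists of `q` copies of `e^{jθ₀} [1 2; 0 1]`. -/
def sectorialCanonicalForm (z p q : ℕ) (θ₀ : ℝ) (θ : Fin p → ℝ) :
    Matrix (Fin z ⊕ (Fin p ⊕ (Fin 2 × Fin q))) (Fin z ⊕ (Fin p ⊕ (Fin 2 × Fin q))) ℂ :=
  Matrix.fromBlocks 0 0 0
    (Matrix.fromBlocks
      (Matrix.diagonal fun i => Complex.exp (θ i * Complex.I)) 0 0
      (Matrix.blockDiagonal fun _ : Fin q =>
        Complex.exp (θ₀ * Complex.I) • (!![1, 2; 0, 1] : Matrix (Fin 2) (Fin 2) ℂ)))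

/-- `HasPhases C Φ`: the multiset `Φ` of real numbers is a list of the phases of `C`, i.e. there is
a decomposition `C = T^* diag(0, D, E) T` with `T` nonsingular, all `θᵢ` within `π/2` of `θ₀`, and
`Φ` consists of the `θᵢ` and of `q` copies each of `θ₀ + π/2` and `θ₀ - π/2`.
Sectorial, quasi-sectorial and rotated Hermitian matrices are the cases with `q = 0`.  The phases
of a nonzero `C` are determined by `C` up to the choice of their centre (`Φ` may be shifted by
`2π`, and by `π` if `C` is rotated Hermitian); the zero matrix has no phases. -/
def HasPhases {m : ℕ} (C : Matrix (Fin m) (Fin m) ℂ) (Φ : Multiset ℝ) : Prop :=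
  ∃ (z p q : ℕ) (e : Fin m ≃ Fin z ⊕ (Fin p ⊕ (Fin 2 × Fin q)))
    (T : Matrix (Fin m) (Fin m) ℂ) (θ₀ : ℝ) (θ : Fin p → ℝ),
    IsUnit T ∧
    (∀ i, θ₀ - Real.pi / 2 ≤ θ i ∧ θ i ≤ θ₀ + Real.pi / 2) ∧
    C = T.conjTranspose * (sectorialCanonicalForm z p q θ₀ θ).submatrix e e * T ∧
    Φ = Finset.univ.val.map θ + Multiset.replicate q (θ₀ + Real.pi / 2)
      + Multiset.replicate q (θ₀ - Real.pi / 2)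

/-- The largest phase; it is `-∞` if there are no phases. -/
def maxPhase (Φ : Multiset ℝ) : EReal := (Φ.map fun x : ℝ => (x : EReal)).sup

/-- The smallest phase; it is `+∞` if there are no phases. -/
def minPhase (Φ : Multiset ℝ) : EReal := (Φ.map fun x : ℝ => (x : EReal)).inf

/-- The phase centre, the midpoint of the largest and the smallest phase (`0` if there are none). -/
def phaseCenter (Φ : Multiset ℝ) : ℝ := ((maxPhase Φ).toReal + (minPhase Φ).toReal) / 2

/-! ### Real rational transfer matrices -/

/-- Square matrices of real rational functions of one variable. -/
abbrev RationalMatrix (m : ℕ) := Matrix (Fin m) (Fin m) (RatFunc ℝ)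

/-- `G` is proper. -/
def IsProperRational {m : ℕ} (G : RationalMatrix m) : Prop :=
  ∀ i k, (G i k).num.natDegree ≤ (G i k).denom.natDegree

/-- `s` is a (finite) pole of some entry of `G`. -/
def IsPole {m : ℕ} (G : RationalMatrix m) (s : ℂ) : Prop :=
  ∃ i k, Polynomial.aeval s (G i k).denom = 0

/-- The value of a proper rational matrix at a point of `ℂ ∪ {∞}` that is not a pole.  The value at
`∞` is the limit; the denominators are monic, so it is read off from the numerators. -/
def valueAt {m : ℕ} (G : RationalMatrix m) (s : OnePoint ℂ) : Matrix (Fin m) (Fin m) ℂ :=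
  s.elim
    (Matrix.of fun i k => (((G i k).num.coeff (G i k).denom.natDegree : ℝ) : ℂ))
    (fun s => Matrix.of fun i k => (G i k).eval (algebraMap ℝ ℂ) s)

/-- `G` has no poles in the open right half plane. -/
def IsSemiStable {m : ℕ} (G : RationalMatrix m) : Prop :=
  ∀ s : ℂ, IsPole G s → s.re ≤ 0

/-- The point `jω` of the imaginary axis. -/
def jw (ω : ℝ) : ℂ := Complex.I * ω

/-- `jω` is a zero of `G` and not a pole: the rank of `G(jω)` is below the normal rank of `G`. -/
def IsAxisZero {m : ℕ} (G : RationalMatrix m) (ω : ℝ) : Prop :=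
  ¬ IsPole G (jw ω) ∧ (valueAt G (jw ω : ℂ)).rank < G.rank

/-- Infinity is a zero of (the proper) `G`. -/
def IsZeroAtInfinity {m : ℕ} (G : RationalMatrix m) : Prop :=
  (valueAt G OnePoint.infty).rank < G.rank

/-- The frequencies of the poles and of the finite zeros of `G` on the imaginary axis. -/
def detourFrequencies {m : ℕ} (G : RationalMatrix m) : Set ℝ :=
  {ω | IsPole G (jw ω) ∨ IsAxisZero G ω}

/-- The indented imaginary axis, for small `ε > 0`: half circles of radius `ε` in the right half
plane go around the poles and the finite zeros on the axis, and a half circle of radius `1/ε` in the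
right half plane replaces the neighbourhood of infinity if infinity is a zero; otherwise
infinity belongs to the contour. -/
def indentedAxis {m : ℕ} (G : RationalMatrix m) (ε : ℝ) : Set (OnePoint ℂ) :=
  {s | ∃ ω : ℝ, s = (jw ω : ℂ) ∧ (∀ ω₀ ∈ detourFrequencies G, ε ≤ |ω - ω₀|) ∧
      (IsZeroAtInfinity G → |ω| ≤ 1 / ε)} ∪
  {s | ∃ w : ℂ, s = w ∧ 0 ≤ w.re ∧ ∃ ω₀ ∈ detourFrequencies G, ‖w - jw ω₀‖ = ε} ∪
  {s | IsZeroAtInfinity G ∧ ∃ w : ℂ, s = w ∧ 0 ≤ w.re ∧ ‖w‖ = 1 / ε} ∪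
  {s | ¬ IsZeroAtInfinity G ∧ s = OnePoint.infty}

/-- The part of the indented imaginary axis in the closed upper half plane (with infinity, if it is
on the contour, as the end point `+j∞`).  As `G` is real, the phases on the rest of the
contour are obtained from those on this part by reflection. -/
def upperIndentedAxis {m : ℕ} (G : RationalMatrix m) (ε : ℝ) : Set (OnePoint ℂ) :=
  {s ∈ indentedAxis G ε | ∀ w : ℂ, s = w → 0 ≤ w.im}

/-- `G` is frequency-wise semi-sectorial: `G(jω)` is semi-sectorial at all `ω ∈ [-∞, ∞]` with `jω`
not a pole, and for all small `ε` the matrix `G(s)` has constant rank and is semi-sectorial along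
the indented imaginary axis. -/
def IsFrequencywiseSemiSectorial {m : ℕ} (G : RationalMatrix m) : Prop :=
  ((∀ ω : ℝ, ¬ IsPole G (jw ω) → IsSemiSectorial (valueAt G (jw ω : ℂ))) ∧
    IsSemiSectorial (valueAt G OnePoint.infty)) ∧
  ∃ ε' : ℝ, 0 < ε' ∧ ∀ ε : ℝ, 0 < ε → ε ≤ ε' →
    ∃ r : ℕ, ∀ s ∈ indentedAxis G ε,
      (valueAt G s).rank = r ∧ IsSemiSectorial (valueAt G s)

/-- The points `jω`, `ω ∈ [0, ∞]`, that are not poles of `G`. -/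
def nonnegFrequencies {m : ℕ} (G : RationalMatrix m) : Set (OnePoint ℂ) :=
  {s | (∃ ω : ℝ, 0 ≤ ω ∧ ¬ IsPole G (jw ω) ∧ s = (jw ω : ℂ)) ∨ s = OnePoint.infty}

/-- The phase response `φ(G(s))` of `G`: a selection of the phases of `G(s)` on the (upper half of
the) indented imaginary axis such that the phase centre is continuous along it and is `0` at its
real starting point, which is `ε` if `0` is a pole or a zero of `G`, and `0` otherwise.
At a zero `s₀` on the imaginary axis or at infinity, where some phases disappear and which the
contour avoids, the remaining phases are selected so that they agree with the phases nearby, i.e.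
they lie, up to any `δ > 0`, between the smallest and the largest phase of `G` at nearby
frequencies. -/
structure PhaseResponse {m : ℕ} (G : RationalMatrix m) where
  phases : OnePoint ℂ → Multiset ℝ
  hasPhases : ∀ s ∈ nonnegFrequencies G, HasPhases (valueAt G s) (phases s)
  exists_contour : ∃ ε' : ℝ, 0 < ε' ∧ ∀ ε : ℝ, 0 < ε → ε ≤ ε' →
    (∀ s ∈ upperIndentedAxis G ε, HasPhases (valueAt G s) (phases s)) ∧
    ContinuousOn (fun s => phaseCenter (phases s)) (upperIndentedAxis G ε) ∧
    (0 ∉ detourFrequencies G → phaseCenter (phases ((0 : ℂ) : OnePoint ℂ)) = 0) ∧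
    (0 ∈ detourFrequencies G → phaseCenter (phases ((ε : ℂ) : OnePoint ℂ)) = 0)
  near_zero : ∀ s₀ ∈ nonnegFrequencies G, (valueAt G s₀).rank < G.rank →
    ∀ δ : ℝ, 0 < δ → ∀ᶠ s in nhdsWithin s₀ (nonnegFrequencies G \ {s₀}),
      minPhase (phases s) ≤ minPhase (phases s₀) + (δ : EReal) ∧
      maxPhase (phases s₀) ≤ maxPhase (phases s) + (δ : EReal)

/-- The maximum phase of `G`: the supremum over `ω ∈ [0, ∞]`, poles excluded. -/
def PhaseResponse.upper {m : ℕ} {G : RationalMatrix m} (φ : PhaseResponse G) : EReal :=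
  ⨆ s ∈ nonnegFrequencies G, maxPhase (φ.phases s)

/-- The minimum phase of `G`: the infimum over `ω ∈ [0, ∞]`, poles excluded. -/
def PhaseResponse.lower {m : ℕ} {G : RationalMatrix m} (φ : PhaseResponse G) : EReal :=
  ⨅ s ∈ nonnegFrequencies G, minPhase (φ.phases s)

/-- The `Φ_∞` sector of `G`. -/
def PhaseResponse.sector {m : ℕ} {G : RationalMatrix m} (φ : PhaseResponse G) : Set ℝ :=
  {x | φ.lower ≤ (x : EReal) ∧ (x : EReal) ≤ φ.upper}

/-- The (frequency-wise semi-sectorial) system `G` is semi-sectorial: its `Φ_∞` sector lies in an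
interval of length at most `π`. -/
def PhaseResponse.IsSemiSectorialSystem {m : ℕ} {G : RationalMatrix m} (φ : PhaseResponse G) :
    Prop :=
  ∃ α β : ℝ, β - α ≤ Real.pi ∧ φ.sector ⊆ Set.Icc α β

/-- `Φ_∞(G) ⊂ [α, β]`, where the interval is taken modulo `2π`. -/
def PhaseResponse.SectorSubset {m : ℕ} {G : RationalMatrix m} (φ : PhaseResponse G) (α β : ℝ) :
    Prop :=
  ∃ k : ℤ, φ.sector ⊆ Set.Icc (α + 2 * Real.pi * k) (β + 2 * Real.pi * k)

/-- The degenerate case for an interval `[α, α + π]`: for every `ω ∈ [0, ∞]`, poles excluded,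
`e^{-jα} G(jω)` is Hermitian, and `Φ_∞(G)` is the complementary interval
`[α + π, α + 2π]` modulo `2π`. -/
def PhaseResponse.IsDegenerate {m : ℕ} {G : RationalMatrix m} (φ : PhaseResponse G) (α : ℝ) :
    Prop :=
  (∀ s ∈ nonnegFrequencies G,
    (Complex.exp (-(α * Complex.I)) • valueAt G s).IsHermitian) ∧
  ∃ k : ℤ, φ.sector =
    Set.Icc (α + Real.pi + 2 * Real.pi * k) (α + 2 * Real.pi + 2 * Real.pi * k)

/-! ### State space realizations and linear matrix inequalities -/

/-- `(A, B, C, D)` is a realization of `G`: `G(s) = C (sI - A)⁻¹ B + D` as rational matrices. -/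
def IsRealization {m n : ℕ} (G : RationalMatrix m) (A : Matrix (Fin n) (Fin n) ℝ)
    (B : Matrix (Fin n) (Fin m) ℝ) (C : Matrix (Fin m) (Fin n) ℝ) (D : Matrix (Fin m) (Fin m) ℝ) :
    Prop :=
  G = C.map RatFunc.C * (Matrix.scalar (Fin n) (RatFunc.X : RatFunc ℝ) - A.map RatFunc.C)⁻¹
    * B.map RatFunc.C + D.map RatFunc.C

/-- A realization is minimal if no realization has a smaller state dimension. -/
def IsMinimalRealization {m n : ℕ} (G : RationalMatrix m) (A : Matrix (Fin n) (Fin n) ℝ)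
    (B : Matrix (Fin n) (Fin m) ℝ) (C : Matrix (Fin m) (Fin n) ℝ) (D : Matrix (Fin m) (Fin m) ℝ) :
    Prop :=
  IsRealization G A B C D ∧
  ∀ (n' : ℕ) (A' : Matrix (Fin n') (Fin n') ℝ) (B' : Matrix (Fin n') (Fin m) ℝ)
    (C' : Matrix (Fin m) (Fin n') ℝ) (D' : Matrix (Fin m) (Fin m) ℝ),
    IsRealization G A' B' C' D' → n ≤ n'

/-- A real matrix as a complex matrix. -/
abbrev toComplexMatrix {k l : Type*} (M : Matrix k l ℝ) : Matrix k l ℂ := M.map Complex.ofReal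

/-- The matrix `M = [0, -e^{jη}C'; -e^{-jη}C, -e^{-jη}D - e^{jη}D']`. -/
def sectorM {m n : ℕ} (C : Matrix (Fin m) (Fin n) ℝ) (D : Matrix (Fin m) (Fin m) ℝ) (η : ℝ) :
    Matrix (Fin n ⊕ Fin m) (Fin n ⊕ Fin m) ℂ :=
  Matrix.fromBlocks 0
    (-(Complex.exp (η * Complex.I) • toComplexMatrix C.transpose))
    (-(Complex.exp (-(η * Complex.I)) • toComplexMatrix C))
    (-(Complex.exp (-(η * Complex.I)) • toComplexMatrix D)
      - Complex.exp (η * Complex.I) • toComplexMatrix D.transpose)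

/-- The pair `(X, Y)` of Hermitian matrices satisfies `Y ≥ 0` and
`[A B; I 0]' [0, X + jY; X - jY, 0] [A B; I 0] + M ≤ 0`, with `M = sectorM C D η`. -/
def SatisfiesSectorLMI {m n : ℕ} (A : Matrix (Fin n) (Fin n) ℝ)
    (B : Matrix (Fin n) (Fin m) ℝ) (C : Matrix (Fin m) (Fin n) ℝ) (D : Matrix (Fin m) (Fin m) ℝ)
    (η : ℝ) (X Y : Matrix (Fin n) (Fin n) ℂ) : Prop :=
  X.IsHermitian ∧ Y.IsHermitian ∧ Y.PosSemidef ∧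
  (-((toComplexMatrix (Matrix.fromBlocks A B (1 : Matrix (Fin n) (Fin n) ℝ) 0)).transpose
      * Matrix.fromBlocks 0 (X + Complex.I • Y) (X - Complex.I • Y) 0
      * toComplexMatrix (Matrix.fromBlocks A B (1 : Matrix (Fin n) (Fin n) ℝ) 0)
      + sectorM C D η)).PosSemidef

/-- The real symmetric `X` satisfies `[A'X + XA, XB - C'; B'X - C, -D - D'] ≤ 0`. -/
def SatisfiesPositiveRealLMI {m n : ℕ} (A : Matrix (Fin n) (Fin n) ℝ)
    (B : Matrix (Fin n) (Fin m) ℝ) (C : Matrix (Fin m) (Fin n) ℝ) (D : Matrix (Fin m) (Fin m) ℝ)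
    (X : Matrix (Fin n) (Fin n) ℝ) : Prop :=
  X.IsSymm ∧
  (-(Matrix.fromBlocks (A.transpose * X + X * A) (X * B - C.transpose)
      (B.transpose * X - C) (-D - D.transpose))).PosSemidef

end

/-! For `β - α ≤ π`, phases in a common translate of `[α, β]` by a multiple of `2π` put the
numerical range of `G(jω)`, for each `ω ∈ [0, ∞]` that is not a pole, in the two half planes `Re
(e^{-jη} z) ≥ 0` with `η = α + π/2` and `η = β - π/2`. Each half plane is treated separately: its
frequency inequality is equivalent to one matrix inequality by a nonstrict generalized KYP lemma for
the half axis `ω ≥ 0`.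

From the matrix inequality to frequencies (`inHalfPlane_of_lmi`), the form is evaluated on solutions
of `Ax + Bu = jωx`. The multiplier contributes `2ω x^*Yx ≥ 0`, so the remaining term, which is `-2
Re (e^{-jη} u^*G(jω)u)`, is at most zero. Points where `A` has an eigenvalue are reached by
continuity.

The converse (`exists_multiplier`) is a duality argument. Minimality gives controllability, which
makes the cone of attainable left-hand sides closed (`eq_zero_of_kypOp_add_eq_zero`). If the
inequality had no solution, a separating functional would yield a positive semidefinite `Z` with `F
Z H^* = jS`, where `F = [A B]`, `H = [I 0]`, `S` is Hermitian and, on the half axis, `S ≥ 0`. Such a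
`Z` splits into rank-one terms, each living at a single frequency or at infinity
(`re_trace_nonpos`), where the frequency inequality contradicts the separation.

Passing from half planes back to phases, test vectors show that each phase lies in some `[α, β] +
2πk`. Phases with different `k` are at least `2π - (β - α) ≥ π` apart, while all of them lie in an
interval of length at most `π`; hence `k` is common unless every inequality is an equality, which is
the degenerate case (`sectorSubset_of_inHalfPlane`).

For `η = 0`, conjugation extends the inequality to negative frequencies because `G` is real. The KYP
lemma on the whole axis then gives `Y = 0`, and entrywise real parts give a real symmetric solution.
-/

namespace SectoredReal

open Matrix

/-! ### Quadratic forms -/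

/-- The real part of the quadratic form of a complex matrix. -/
def quad {N : Type*} [Fintype N] (M : Matrix N N ℂ) (x : N → ℂ) : ℝ := (star x ⬝ᵥ M *ᵥ x).re

section Quad

variable {N K : Type*} [Fintype N] [Fintype K]

lemma quad_add (M M' : Matrix N N ℂ) (x : N → ℂ) : quad (M + M') x = quad M x + quad M' x := by
  simp [quad, add_mulVec]

lemma quad_neg (M : Matrix N N ℂ) (x : N → ℂ) : quad (-M) x = -quad M x := by
  simp [quad, neg_mulVec]

lemma star_dotProduct_conjTranspose_mulVec (M : Matrix N N ℂ) (x : N → ℂ) :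
    star x ⬝ᵥ Mᴴ *ᵥ x = star (star x ⬝ᵥ M *ᵥ x) := by
  rw [star_dotProduct, star_mulVec, dotProduct_mulVec]
  simp [dotProduct_comm]

lemma quad_conjTranspose (M : Matrix N N ℂ) (x : N → ℂ) : quad Mᴴ x = quad M x := by
  rw [quad, star_dotProduct_conjTranspose_mulVec]
  simp [quad]

lemma star_dotProduct_mul_mulVec (W : Matrix K N ℂ) (M : Matrix K K ℂ) (x : N → ℂ) :
    star x ⬝ᵥ (Wᴴ * M * W) *ᵥ x = star (W *ᵥ x) ⬝ᵥ M *ᵥ (W *ᵥ x) := by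
  rw [star_mulVec, ← dotProduct_mulVec, mulVec_mulVec, mulVec_mulVec, Matrix.mul_assoc]

lemma quad_conj (W : Matrix K N ℂ) (M : Matrix K K ℂ) (x : N → ℂ) :
    quad (Wᴴ * M * W) x = quad M (W *ᵥ x) := by
  rw [quad, star_dotProduct_mul_mulVec, quad]

lemma posSemidef_iff_quad {M : Matrix N N ℂ} :
    M.PosSemidef ↔ M.IsHermitian ∧ ∀ x, 0 ≤ quad M x := by
  rw [posSemidef_iff_dotProduct_mulVec]
  refine and_congr_right fun hM => forall_congr' fun x => ?_
  rw [Complex.le_def]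
  have h : star (star x ⬝ᵥ M *ᵥ x) = star x ⬝ᵥ M *ᵥ x := by
    rw [← star_dotProduct_conjTranspose_mulVec, hM.eq]
  have h' := congrArg Complex.im h
  simp only [RCLike.star_def, Complex.conj_im] at h'
  simp only [quad, Complex.zero_re, Complex.zero_im]
  constructor
  · exact fun h => h.1
  · exact fun h => ⟨h, by linarith⟩

lemma continuous_quad (x : N → ℂ) : Continuous fun M : Matrix N N ℂ => quad M x := by
  unfold quad
  fun_prop

lemma isClosed_posSemidef : IsClosed {M : Matrix N N ℂ | M.PosSemidef} := by
  simp only [posSemidef_iff_quad, Set.ofPred_and, Set.ofPred_forall]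
  refine IsClosed.inter (isClosed_eq (by fun_prop) continuous_id) (isClosed_iInter fun x => ?_)
  exact isClosed_le continuous_const (continuous_quad x)

lemma conjTranspose_mul_mul_diag {L : Type*} (U : Matrix N L ℂ) (M : Matrix N N ℂ) (k : L) :
    (Uᴴ * M * U) k k = star (fun i => U i k) ⬝ᵥ M *ᵥ fun i => U i k := by
  rw [Matrix.mul_assoc, Matrix.mul_apply']
  rfl

lemma trace_mul_vecMulVec_star (W : Matrix N N ℂ) (x : N → ℂ) :
    (W * vecMulVec x (star x)).trace = star x ⬝ᵥ W *ᵥ x := by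
  rw [mul_vecMulVec, trace_vecMulVec, dotProduct_comm]

lemma re_trace_conjTranspose (W : Matrix N N ℂ) : Wᴴ.trace.re = W.trace.re := by
  rw [trace_conjTranspose]; simp

/-- The Hermitian part is positive semidefinite with zero form, and a semidefinite matrix
annihilates every vector at which its form vanishes. -/
lemma add_conjTranspose_eq_zero_of_quad {M : Matrix N N ℂ} (h : ∀ x, quad M x = 0) : M + Mᴴ = 0 := by
  have h1 : (M + Mᴴ).PosSemidef := posSemidef_iff_quad.2
    ⟨isHermitian_add_transpose_self M, fun x => by rw [quad_add, quad_conjTranspose, h]; simp⟩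
  classical
  ext1 i j
  have hz : (M + Mᴴ) *ᵥ (Pi.single j 1) = 0 := by
    rw [← h1.dotProduct_mulVec_zero_iff]
    have h2 := (posSemidef_iff_dotProduct_mulVec.1 h1).2 (Pi.single j 1)
    refine Complex.ext ?_ (Complex.le_def.1 h2).2.symm
    change quad _ _ = 0
    rw [quad_add, quad_conjTranspose, h, add_zero]
  simpa using congrFun hz i

end Quad

/-! ### Spectral decompositions, pseudoinverses and a rank-one splitting of traces. -/

section Spectral

variable {N a : Type*} [Fintype N] [DecidableEq N] [Fintype a]

lemma exists_unitary_diagonal {M : Matrix N N ℂ} (hM : M.IsHermitian) :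
    ∃ (U : Matrix N N ℂ) (d : N → ℝ), U * Uᴴ = 1 ∧ Uᴴ * U = 1 ∧
      M = U * diagonal (fun i => (d i : ℂ)) * Uᴴ ∧ (M.PosSemidef → ∀ i, 0 ≤ d i) := by
  refine ⟨hM.eigenvectorUnitary, hM.eigenvalues, ?_, ?_, ?_, fun h i => h.eigenvalues_nonneg i⟩
  · exact Unitary.coe_mul_star_self _
  · exact Unitary.coe_star_mul_self _
  · exact hM.spectral_theorem

lemma exists_eq_mul_conjTranspose {M : Matrix N N ℂ} (hM : M.PosSemidef) :
    ∃ V : Matrix N N ℂ, M = V * Vᴴ := by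
  obtain ⟨U, d, -, -, h, hd⟩ := exists_unitary_diagonal hM.1
  refine ⟨U * diagonal fun i => (Real.sqrt (d i) : ℂ), ?_⟩
  have : (fun i => (d i : ℂ)) = fun i => (Real.sqrt (d i) : ℂ) * (Real.sqrt (d i) : ℂ) := by
    ext i
    rw [← Complex.ofReal_mul, Real.mul_self_sqrt (hd hM i)]
  rw [h, this, ← diagonal_mul_diagonal, conjTranspose_mul, diagonal_conjTranspose]
  simp only [Matrix.mul_assoc]
  congr! 4
  ext i
  simp

/-- A generalized inverse `G` of `H` for which `G H` is an orthogonal projection. -/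
lemma exists_pseudoInverse (H : Matrix a N ℂ) : ∃ G : Matrix N a ℂ,
    H * G * H = H ∧ (G * H).IsHermitian := by
  obtain ⟨U, d, h1, h2, h3, -⟩ := exists_unitary_diagonal (isHermitian_conjTranspose_mul_self H)
  -- Since `0⁻¹ = 0`, this is the Moore–Penrose inverse of `Hᴴ * H`; the pseudoinverse of `H` will
  -- be `E * Hᴴ`.
  set E : Matrix N N ℂ := U * diagonal (fun i => (d i : ℂ)⁻¹) * Uᴴ with hE
  have hEG : E * (Hᴴ * H) = U * diagonal (fun i => (d i : ℂ)⁻¹ * d i) * Uᴴ := by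
    rw [h3, hE, ← diagonal_mul_diagonal]
    simp only [Matrix.mul_assoc]
    rw [← Matrix.mul_assoc Uᴴ U, h2, Matrix.one_mul]
  have hP : (E * (Hᴴ * H)).IsHermitian := by
    rw [IsHermitian, hEG, conjTranspose_mul, conjTranspose_mul, diagonal_conjTranspose,
      conjTranspose_conjTranspose, Matrix.mul_assoc]
    congr! 3
    ext i
    simp
  have hGP : (Hᴴ * H) * (E * (Hᴴ * H)) = Hᴴ * H := by
    rw [hEG]
    conv_lhs => rw [h3]
    conv_rhs => rw [h3]
    simp only [Matrix.mul_assoc]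
    rw [← Matrix.mul_assoc Uᴴ U, h2, Matrix.one_mul, ← Matrix.mul_assoc (diagonal _),
      diagonal_mul_diagonal]
    congr! 3
    ext i
    by_cases hi : (d i : ℂ) = 0 <;> simp [hi]
  refine ⟨E * Hᴴ, ?_, ?_⟩
  · have h0 : (H * (E * Hᴴ) * H - H)ᴴ * (H * (E * Hᴴ) * H - H) = 0 := by
      have e1 : H * (E * Hᴴ) * H = H * (E * (Hᴴ * H)) := by simp only [Matrix.mul_assoc]
      have e2 : (H * (E * (Hᴴ * H)))ᴴ = E * (Hᴴ * H) * Hᴴ := by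
        rw [conjTranspose_mul, hP.eq]
      rw [e1, conjTranspose_sub, e2, Matrix.sub_mul, Matrix.mul_sub, Matrix.mul_sub,
        Matrix.mul_assoc (E * (Hᴴ * H)), ← Matrix.mul_assoc Hᴴ H (E * _), hGP,
        Matrix.mul_assoc _ Hᴴ H]
      simp
    exact sub_eq_zero.1 (conjTranspose_mul_self_eq_zero.1 h0)
  · rw [Matrix.mul_assoc]; exact hP

/-- If `F Hᴴ = jS` with `S` Hermitian, then the trace of `Q` is a sum of values of its quadratic form
at vectors `v` with `F v = jω H v` or `H v = 0`. -/
lemma re_trace_nonpos {full : Prop} {F H : Matrix a N ℂ} {S : Matrix a a ℂ} {Q : Matrix N N ℂ}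
    (hS : S.IsHermitian) (hFH : F * Hᴴ = Complex.I • S) (hpos : ¬ full → S.PosSemidef)
    (hQ : ∀ (v : N → ℂ) (ω : ℝ), (¬ full → 0 ≤ ω) → F *ᵥ v = (Complex.I * ω) • H *ᵥ v →
      quad Q v ≤ 0)
    (hQ0 : ∀ v, H *ᵥ v = 0 → quad Q v ≤ 0) : Q.trace.re ≤ 0 := by
  obtain ⟨G, hHGH, hGH⟩ := exists_pseudoInverse H
  set P := G * H with hP
  have hHP : H * P = H := by rw [hP, ← Matrix.mul_assoc, hHGH]
  have hPP : P * P = P := by rw [hP, Matrix.mul_assoc, ← Matrix.mul_assoc H, hHGH]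
  -- `R` turns the relation between `F` and `H` into `F P = j H R`. An eigenvector of `R` with
  -- eigenvalue `d`, projected by `P`, therefore satisfies `F v = j d H v`, and `d ≥ 0` when `S` is
  -- positive semidefinite.
  set R := G * S * Gᴴ with hR
  have hRh : R.IsHermitian := isHermitian_mul_mul_conjTranspose G hS
  have hSF : S = (-Complex.I) • (F * Hᴴ) := by rw [hFH, smul_smul]; simp
  have hHGS : H * G * S = S := by
    have e : S = Complex.I • (H * Fᴴ) := by
      rw [← hS.eq, hSF, conjTranspose_smul, conjTranspose_mul, conjTranspose_conjTranspose]
      simp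
    rw [e, Matrix.mul_smul, ← Matrix.mul_assoc, hHGH]
  have hFP : F * P = Complex.I • (H * R) := by
    have e : H * R = S * Gᴴ := by
      rw [hR, ← Matrix.mul_assoc, ← Matrix.mul_assoc, hHGS]
    rw [e, hSF, Matrix.smul_mul, smul_smul, Matrix.mul_assoc, ← conjTranspose_mul, hGH.eq]
    simp
  obtain ⟨U, d, h1, h2, h3, hd⟩ := exists_unitary_diagonal hRh
  have hRU : R * U = U * diagonal fun i => (d i : ℂ) := by
    rw [h3, Matrix.mul_assoc, h2, Matrix.mul_one]
  -- The trace splits along the orthogonal projections `P` and `1 - P`. On the first part the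
  -- eigenbasis of `R` is used; the columns of `1 - P` lie in the kernel of `H`.
  have ht : Q.trace = ((P * U)ᴴ * Q * (P * U)).trace + ((1 - P) * Q * (1 - P)).trace := by
    rw [conjTranspose_mul, hGH.eq]
    have e1 : (Uᴴ * P * Q * (P * U)).trace = (Q * P).trace := by
      rw [← Matrix.mul_assoc (Uᴴ * P * Q), Matrix.trace_mul_comm, Matrix.mul_assoc Uᴴ,
        Matrix.mul_assoc Uᴴ, ← Matrix.mul_assoc U, h1, Matrix.one_mul, Matrix.mul_assoc P,
        Matrix.trace_mul_comm, Matrix.mul_assoc, hPP]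
    have e2 : ((1 - P) * Q * (1 - P)).trace = (Q * (1 - P)).trace := by
      rw [Matrix.mul_assoc, Matrix.trace_mul_comm, Matrix.mul_assoc]
      congr 2
      rw [Matrix.mul_sub, Matrix.sub_mul, Matrix.sub_mul, hPP]
      simp
    rw [e1, e2, ← trace_add, ← Matrix.mul_add]
    simp
  rw [ht, Complex.add_re, trace, trace, Complex.re_sum, Complex.re_sum]
  refine add_nonpos (Finset.sum_nonpos fun k _ => ?_) (Finset.sum_nonpos fun k _ => ?_)
  · rw [diag_apply, conjTranspose_mul_mul_diag]
    refine hQ _ (d k) (fun hf => hd ?_ k) ?_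
    · exact (hpos hf).mul_mul_conjTranspose_same G
    · have e : F * (P * U) = Complex.I • (H * (P * U) * diagonal fun i => (d i : ℂ)) := by
        rw [← Matrix.mul_assoc F, hFP, ← Matrix.mul_assoc H P, hHP, Matrix.smul_mul,
          Matrix.mul_assoc H R, hRU, Matrix.mul_assoc]
      ext i
      have := congrFun (congrFun e i) k
      rw [Matrix.smul_apply, mul_diagonal, Matrix.mul_apply', Matrix.mul_apply'] at this
      rw [Pi.smul_apply, smul_eq_mul, mulVec, mulVec, mul_assoc, mul_comm (d k : ℂ)]
      exact this
  · have hP1 : (1 - P)ᴴ = 1 - P := by rw [conjTranspose_sub, hGH.eq, conjTranspose_one]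
    have e := conjTranspose_mul_mul_diag (1 - P) Q k
    rw [hP1] at e
    rw [diag_apply, e]
    refine hQ0 _ ?_
    have e : H * (1 - P) = 0 := by rw [Matrix.mul_sub, hHP, Matrix.mul_one, sub_self]
    ext i
    have := congrFun (congrFun e i) k
    rwa [Matrix.mul_apply'] at this

end Spectral

/-! ### Closed convex cones: linear images and separation. -/

section Cone

/-- The image of a closed cone under a linear map that vanishes on it only at `0` is closed. -/
lemma isClosed_image_of_cone {E F : Type*} [NormedAddCommGroup E] [NormedSpace ℝ E]
    [FiniteDimensional ℝ E] [NormedAddCommGroup F] [NormedSpace ℝ F] (f : E →L[ℝ] F) {K : Set E}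
    (hK : IsClosed K) (hcone : ∀ c : ℝ, 0 ≤ c → ∀ x ∈ K, c • x ∈ K)
    (hker : ∀ x ∈ K, f x = 0 → x = 0) : IsClosed (f '' K) := by
  have : ProperSpace E := FiniteDimensional.proper ℝ E
  -- The minimum of `‖f x‖` over the compact set of unit vectors of `K` is positive. The resulting
  -- bound keeps preimages of a convergent sequence bounded, so a subsequence of them converges.
  obtain ⟨c, hc, hcf⟩ : ∃ c : ℝ, 0 < c ∧ ∀ x ∈ K, c * ‖x‖ ≤ ‖f x‖ := by
    have hcomp : IsCompact (Metric.sphere (0 : E) 1 ∩ K) := (isCompact_sphere 0 1).inter_right hK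
    rcases (Metric.sphere (0 : E) 1 ∩ K).eq_empty_or_nonempty with h | h
    · refine ⟨1, one_pos, fun x hx => ?_⟩
      by_cases hx0 : x = 0
      · simp [hx0]
      · have : ‖x‖⁻¹ • x ∈ Metric.sphere (0 : E) 1 ∩ K :=
          ⟨by simp [norm_smul, hx0], hcone _ (by positivity) x hx⟩
        rw [h] at this
        exact this.elim
    · obtain ⟨y, hy, hmin⟩ := hcomp.exists_isMinOn h (f := fun x => ‖f x‖) (by fun_prop)
      have hy0 : y ≠ 0 := by
        rintro rfl
        simpa using hy.1
      refine ⟨‖f y‖, norm_pos_iff.2 fun h0 => hy0 (hker y hy.2 h0), fun x hx => ?_⟩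
      by_cases hx0 : x = 0
      · simp [hx0]
      · have hm : ‖x‖⁻¹ • x ∈ Metric.sphere (0 : E) 1 ∩ K :=
          ⟨by simp [norm_smul, hx0], hcone _ (by positivity) x hx⟩
        have h1 : ‖f y‖ ≤ ‖f (‖x‖⁻¹ • x)‖ := hmin hm
        rw [map_smul, norm_smul, norm_inv, norm_norm, inv_mul_eq_div,
          le_div_iff₀ (norm_pos_iff.2 hx0)] at h1
        exact h1
  refine IsSeqClosed.isClosed fun y z hy hz => ?_
  choose x hxK hxy using hy
  obtain ⟨b, hb⟩ := (Metric.isBounded_range_of_tendsto y hz).exists_norm_le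
  have hxb : ∀ k, x k ∈ Metric.closedBall (0 : E) (b / c) := fun k => by
    rw [mem_closedBall_zero_iff, le_div_iff₀ hc, mul_comm]
    exact (hcf _ (hxK k)).trans (by rw [hxy]; exact hb _ ⟨k, rfl⟩)
  obtain ⟨w, -, ψ, hψ, hw⟩ := tendsto_subseq_of_bounded Metric.isBounded_closedBall hxb
  refine ⟨w, hK.mem_of_tendsto hw (Filter.Eventually.of_forall fun k => hxK _), ?_⟩
  refine tendsto_nhds_unique ((f.continuous.tendsto w).comp hw) ?_
  have : (f ∘ x ∘ ψ) = y ∘ ψ := by ext k; simp [hxy]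
  rw [this]
  exact hz.comp hψ.tendsto_atTop

/-- A point outside a closed convex cone is separated from it by a functional. -/
lemma exists_separating_functional {E : Type*} [NormedAddCommGroup E] [NormedSpace ℝ E] {K : Set E}
    (hK : IsClosed K) (hconv : Convex ℝ K) (h0 : (0 : E) ∈ K)
    (hcone : ∀ c : ℝ, 0 ≤ c → ∀ x ∈ K, c • x ∈ K) {x : E} (hx : x ∉ K) :
    ∃ f : E →L[ℝ] ℝ, f x < 0 ∧ ∀ y ∈ K, 0 ≤ f y := by
  obtain ⟨f, u, hu, hf⟩ := geometric_hahn_banach_point_closed hconv hK hx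
  have hu0 : u < 0 := by simpa using hf 0 h0
  refine ⟨f, hu.trans hu0, fun y hy => ?_⟩
  by_contra! hneg
  -- This nonnegative multiple of `y` stays in `K`, yet `f` takes the value `u` there, which must
  -- lie strictly below all values on `K`.
  have := hf ((u / f y) • y) (hcone _ (div_nonneg_of_nonpos hu0.le hneg.le) y hy)
  rw [map_smul, smul_eq_mul, div_mul_cancel₀ _ hneg.ne] at this
  exact lt_irrefl _ this

end Cone

/-- The functional is only real linear, so its values on `E_ij` and on `j E_ij` are independent real
numbers `a` and `b`. The entry `a - jb` of `W` encodes both, because `Re ((a - jb)(x + jy)) = ax +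
by`. -/
lemma exists_trace_repr {N : Type*} [Fintype N] [DecidableEq N] (f : Matrix N N ℂ →ₗ[ℝ] ℝ) :
    ∃ W : Matrix N N ℂ, ∀ M, f M = (W * M).trace.re := by
  refine ⟨Matrix.of fun j i => (f (single i j 1) : ℂ) - Complex.I * f (single i j Complex.I),
    fun M => ?_⟩
  have hs : ∀ i j, f (single i j (M i j)) =
      (M i j).re * f (single i j 1) + (M i j).im * f (single i j Complex.I) := fun i j => by
    have : (single i j (M i j) : Matrix N N ℂ) =
        (M i j).re • single i j 1 + (M i j).im • single i j Complex.I := by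
      rw [smul_single, smul_single, ← single_add]
      congr 1
      simp [Complex.real_smul]
    rw [this, map_add, map_smul, map_smul, smul_eq_mul, smul_eq_mul]
  conv_lhs => rw [matrix_eq_sum_single M]
  simp only [map_sum, hs, trace, diag_apply, Matrix.mul_apply, of_apply, Complex.re_sum]
  rw [Finset.sum_comm]
  refine Finset.sum_congr rfl fun i _ => Finset.sum_congr rfl fun j _ => ?_
  simp
  ring

/-! ### The generalized Kalman–Yakubovich–Popov lemma on a half axis -/

section KYP

variable {n m : ℕ}

/-- `(A, B)` is controllable: an `A`-invariant subspace that contains the range of `B` is everything. -/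
def IsControllablePair (A : Matrix (Fin n) (Fin n) ℂ) (B : Matrix (Fin n) (Fin m) ℂ) : Prop :=
  ∀ V : Submodule ℂ (Fin n → ℂ), (∀ u, B *ᵥ u ∈ V) → (∀ x ∈ V, A *ᵥ x ∈ V) → V = ⊤

/-- The matrix `[I 0]` that extracts the state from a vector of states and inputs. -/
abbrev statePart (n m : ℕ) : Matrix (Fin n) (Fin n ⊕ Fin m) ℂ := fromCols 1 0

/-- The left hand side `[A B; I 0]^* [0 P; P^* 0] [A B; I 0]` of the matrix inequality. -/
def kypOp (A : Matrix (Fin n) (Fin n) ℂ) (B : Matrix (Fin n) (Fin m) ℂ)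
    (P : Matrix (Fin n) (Fin n) ℂ) : Matrix (Fin n ⊕ Fin m) (Fin n ⊕ Fin m) ℂ :=
  (fromCols A B)ᴴ * P * statePart n m + (statePart n m)ᴴ * Pᴴ * fromCols A B

/-- The multipliers `P = X + jY`, `X` Hermitian, where `Y ≥ 0`, and `Y = 0` if `full` holds. -/
def multiplierCone (n : ℕ) (full : Prop) : Set (Matrix (Fin n) (Fin n) ℂ) :=
  {P | ((-Complex.I) • (P - Pᴴ)).PosSemidef ∧ (full → P.IsHermitian)}

variable {A : Matrix (Fin n) (Fin n) ℂ} {B : Matrix (Fin n) (Fin m) ℂ}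

lemma statePart_mulVec (v : Fin n ⊕ Fin m → ℂ) :
    statePart n m *ᵥ v = v ∘ Sum.inl := by
  rw [fromCols_mulVec]; simp

lemma kypOp_mulVec (P : Matrix (Fin n) (Fin n) ℂ) (v : Fin n ⊕ Fin m → ℂ) :
    kypOp A B P *ᵥ v = (fromCols A B)ᴴ *ᵥ (P *ᵥ (v ∘ Sum.inl)) +
      (statePart n m)ᴴ *ᵥ (Pᴴ *ᵥ (fromCols A B *ᵥ v)) := by
  rw [kypOp, add_mulVec, ← mulVec_mulVec, ← mulVec_mulVec, ← mulVec_mulVec, ← mulVec_mulVec,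
    statePart_mulVec]

lemma star_dotProduct_kypOp_mulVec (P : Matrix (Fin n) (Fin n) ℂ) (v : Fin n ⊕ Fin m → ℂ) :
    star v ⬝ᵥ kypOp A B P *ᵥ v = star (fromCols A B *ᵥ v) ⬝ᵥ P *ᵥ (v ∘ Sum.inl) +
      star (P *ᵥ (v ∘ Sum.inl)) ⬝ᵥ (fromCols A B *ᵥ v) := by
  rw [kypOp_mulVec, dotProduct_add, dotProduct_mulVec, ← star_mulVec, dotProduct_mulVec _ _ᴴ,
    ← star_mulVec, statePart_mulVec, dotProduct_mulVec _ Pᴴ, ← star_mulVec]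

lemma isHermitian_kypOp (P : Matrix (Fin n) (Fin n) ℂ) : (kypOp A B P).IsHermitian := by
  rw [IsHermitian, kypOp, conjTranspose_add, add_comm]
  simp only [conjTranspose_mul, conjTranspose_conjTranspose, Matrix.mul_assoc]

/-- At a vector with `A x + B u = jω x` the form of the left hand side is `2ω x^* Y x`. -/
lemma quad_kypOp_nonneg {P : Matrix (Fin n) (Fin n) ℂ}
    (hP : ((-Complex.I) • (P - Pᴴ)).PosSemidef) {v : Fin n ⊕ Fin m → ℂ} {ω : ℝ} (hω : 0 ≤ ω)
    (hv : fromCols A B *ᵥ v = (Complex.I * ω) • (v ∘ Sum.inl)) : 0 ≤ quad (kypOp A B P) v := by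
  have h := (posSemidef_iff_quad.1 hP).2 (v ∘ Sum.inl)
  have e : star v ⬝ᵥ kypOp A B P *ᵥ v =
      ω * (star (v ∘ Sum.inl) ⬝ᵥ ((-Complex.I) • (P - Pᴴ)) *ᵥ (v ∘ Sum.inl)) := by
    rw [star_dotProduct_kypOp_mulVec, hv, smul_mulVec, sub_mulVec, star_mulVec, star_smul,
      dotProduct_smul, dotProduct_smul, smul_dotProduct, dotProduct_sub, ← dotProduct_mulVec]
    simp
    ring
  rw [quad, e, Complex.re_ofReal_mul]
  exact mul_nonneg hω h

/-- This is where controllability enters the duality argument: it makes the cone of left-hand sides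
closed. If `P` kills the state part of `v`, the form of `R = -kypOp A B P` vanishes at `v`, so `R v
= 0`, and reading off the state rows gives `Pᴴ (Ax + Bu) = 0`. On the kernel of `Pᴴ` the form of the
semidefinite `-j(P - Pᴴ)` vanishes, so `P` vanishes there too. That kernel thus contains the range
of `B` and is `A`-invariant, hence is everything. -/
lemma eq_zero_of_kypOp_add_eq_zero (hc : IsControllablePair A B) {P : Matrix (Fin n) (Fin n) ℂ}
    {R : Matrix (Fin n ⊕ Fin m) (Fin n ⊕ Fin m) ℂ}
    (hP : ((-Complex.I) • (P - Pᴴ)).PosSemidef) (hR : R.PosSemidef) (h : kypOp A B P + R = 0) :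
    P = 0 ∧ R = 0 := by
  have hRk : R = -kypOp A B P := by rw [eq_neg_iff_add_eq_zero, add_comm, h]
  have key : ∀ v : Fin n ⊕ Fin m → ℂ, P *ᵥ (v ∘ Sum.inl) = 0 →
      Pᴴ *ᵥ (fromCols A B *ᵥ v) = 0 := by
    intro v hv
    have h0 : R *ᵥ v = 0 := by
      rw [← hR.dotProduct_mulVec_zero_iff, hRk, neg_mulVec, dotProduct_neg,
        star_dotProduct_kypOp_mulVec, hv]
      simp
    rw [hRk, neg_mulVec, neg_eq_zero, kypOp_mulVec, hv, mulVec_zero, zero_add] at h0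
    have h1 := congrArg (fun w => statePart n m *ᵥ w) h0
    simp only [mulVec_mulVec, mulVec_zero] at h1
    rw [← Matrix.mul_assoc] at h1
    have e : statePart n m *
        (statePart n m)ᴴ = 1 := by
      rw [conjTranspose_fromCols_eq_fromRows_conjTranspose, fromCols_mul_fromRows]
      simp
    rwa [e, Matrix.one_mul, ← mulVec_mulVec] at h1
  have hV := hc (LinearMap.ker (mulVecLin Pᴴ)) (fun u => by
      have := key (Sum.elim 0 u) (by simp)
      rwa [fromCols_mulVec, Sum.elim_comp_inl, Sum.elim_comp_inr, mulVec_zero, zero_add] at this)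
    (fun x hx => by
      rw [LinearMap.mem_ker, mulVecLin_apply] at hx
      have h1 : star x ⬝ᵥ P *ᵥ x = 0 := by
        rw [← star_eq_zero, ← star_dotProduct_conjTranspose_mulVec, hx, dotProduct_zero]
      have h2 : (P - Pᴴ) *ᵥ x = 0 := by
        have h3 := (hP.dotProduct_mulVec_zero_iff x).1 (by
          rw [smul_mulVec, sub_mulVec, hx, sub_zero, dotProduct_smul, h1, smul_zero])
        rw [smul_mulVec] at h3
        exact (smul_eq_zero.1 h3).resolve_left (by simp)
      have h3 := key (Sum.elim x 0) (by
        rw [sub_mulVec, hx, sub_zero] at h2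
        simpa using h2)
      rwa [fromCols_mulVec, Sum.elim_comp_inl, Sum.elim_comp_inr, mulVec_zero, add_zero] at h3)
  have hP0 : Pᴴ = 0 := by
    ext i j
    have : (Pi.single j 1 : Fin n → ℂ) ∈ LinearMap.ker (mulVecLin Pᴴ) := by rw [hV]; trivial
    rw [LinearMap.mem_ker, mulVecLin_apply] at this
    simpa using congrFun this i
  have hP0' : P = 0 := conjTranspose_eq_zero.1 hP0
  refine ⟨hP0', ?_⟩
  rw [hRk, hP0']
  simp [kypOp]

open scoped Matrix.Norms.Elementwise in
/-- The nonstrict generalized KYP lemma: for a controllable pair, the frequency domain inequality on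
the nonnegative half axis (the whole axis if `full` holds) and at infinity implies the matrix
inequality. -/
theorem exists_multiplier {full : Prop} (hc : IsControllablePair A B)
    {Q : Matrix (Fin n ⊕ Fin m) (Fin n ⊕ Fin m) ℂ} (hQ : Q.IsHermitian)
    (hfdi : ∀ (v : Fin n ⊕ Fin m → ℂ) (ω : ℝ), (¬ full → 0 ≤ ω) →
      fromCols A B *ᵥ v = (Complex.I * ω) • (v ∘ Sum.inl) → quad Q v ≤ 0)
    (hinf : ∀ v : Fin n ⊕ Fin m → ℂ, v ∘ Sum.inl = 0 → quad Q v ≤ 0) :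
    ∃ P ∈ multiplierCone n full, (-(kypOp A B P + Q)).PosSemidef := by
  let L : (Matrix (Fin n) (Fin n) ℂ × Matrix (Fin n ⊕ Fin m) (Fin n ⊕ Fin m) ℂ) →ₗ[ℝ]
      Matrix (Fin n ⊕ Fin m) (Fin n ⊕ Fin m) ℂ :=
    { toFun := fun p => kypOp A B p.1 + p.2
      map_add' := fun p q => by
        simp only [kypOp, Prod.fst_add, Prod.snd_add, Matrix.mul_add, Matrix.add_mul,
          conjTranspose_add]
        abel
      map_smul' := fun c p => by
        simp [kypOp, Matrix.mul_smul, Matrix.smul_mul, conjTranspose_smul] }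
  let K : Set (Matrix (Fin n) (Fin n) ℂ × Matrix (Fin n ⊕ Fin m) (Fin n ⊕ Fin m) ℂ) :=
    {p | p.1 ∈ multiplierCone n full ∧ p.2.PosSemidef}
  have hKadd : ∀ p ∈ K, ∀ q ∈ K, p + q ∈ K := by
    rintro p ⟨⟨hp1, hp2⟩, hp3⟩ q ⟨⟨hq1, hq2⟩, hq3⟩
    refine ⟨⟨?_, fun hf => (hp2 hf).add (hq2 hf)⟩, hp3.add hq3⟩
    have e : (-Complex.I) • ((p + q).1 - (p + q).1ᴴ) =
        (-Complex.I) • (p.1 - p.1ᴴ) + (-Complex.I) • (q.1 - q.1ᴴ) := by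
      rw [Prod.fst_add, conjTranspose_add, ← smul_add]
      congr 1
      abel
    rw [e]
    exact hp1.add hq1
  have hsm : ∀ {N : Type} [Fintype N] (M : Matrix N N ℂ) (c : ℝ), 0 ≤ c → M.PosSemidef →
      (c • M).PosSemidef := fun M c hc hM => by
    have := hM.smul (show (0 : ℂ) ≤ (c : ℂ) by exact_mod_cast hc)
    exact this
  have hKcone : ∀ c : ℝ, 0 ≤ c → ∀ p ∈ K, c • p ∈ K := by
    rintro c hc p ⟨⟨hp1, hp2⟩, hp3⟩
    refine ⟨⟨?_, fun hf => ?_⟩, hsm _ c hc hp3⟩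
    · have e : (-Complex.I) • ((c • p).1 - (c • p).1ᴴ) = c • ((-Complex.I) • (p.1 - p.1ᴴ)) := by
        rw [Prod.smul_fst, conjTranspose_smul, star_trivial, ← smul_sub, smul_comm]
      rw [e]
      exact hsm _ c hc hp1
    · rw [Prod.smul_fst, IsHermitian, conjTranspose_smul, (hp2 hf).eq]
      simp
  have hKclosed : IsClosed K := by
    have h1 : IsClosed {p : Matrix (Fin n) (Fin n) ℂ × Matrix (Fin n ⊕ Fin m) (Fin n ⊕ Fin m) ℂ |
        ((-Complex.I) • (p.1 - p.1ᴴ)).PosSemidef} :=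
      isClosed_posSemidef.preimage (by fun_prop)
    have h2 : IsClosed {p : Matrix (Fin n) (Fin n) ℂ × Matrix (Fin n ⊕ Fin m) (Fin n ⊕ Fin m) ℂ |
        full → p.1.IsHermitian} := by
      by_cases hf : full
      · simp only [hf, true_imp_iff]
        exact isClosed_eq (by fun_prop) (by fun_prop)
      · simp [hf]
    exact (h1.inter h2).inter (isClosed_posSemidef.preimage continuous_snd)
  have hK0 : (0 : Matrix (Fin n) (Fin n) ℂ × Matrix (Fin n ⊕ Fin m) (Fin n ⊕ Fin m) ℂ) ∈ K := by
    refine ⟨⟨?_, fun _ => ?_⟩, PosSemidef.zero⟩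
    · simpa using PosSemidef.zero
    · simp
  -- Without closedness, separation would only yield approximate solvability; this is what allows
  -- nonstrict inequalities.
  have hclosed : IsClosed (LinearMap.toContinuousLinearMap L '' K) :=
    isClosed_image_of_cone _ hKclosed hKcone fun p hp h0 => by
      obtain ⟨h1, h2⟩ := eq_zero_of_kypOp_add_eq_zero hc hp.1.1 hp.2 h0
      exact Prod.ext h1 h2
  have hconv : Convex ℝ (LinearMap.toContinuousLinearMap L '' K) := by
    have : Convex ℝ K := fun p hp q hq a b ha hb _ =>
      hKadd _ (hKcone a ha p hp) _ (hKcone b hb q hq)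
    exact this.linear_image L
  by_contra hne
  have hnot : -Q ∉ LinearMap.toContinuousLinearMap L '' K := by
    rintro ⟨p, hp, hpQ⟩
    have e : kypOp A B p.1 + p.2 = -Q := hpQ
    refine hne ⟨p.1, hp.1, ?_⟩
    have : p.2 = -(kypOp A B p.1 + Q) := by
      rw [← neg_eq_iff_eq_neg.2 e]
      abel
    rw [← this]
    exact hp.2
  obtain ⟨f, hfQ, hf⟩ := exists_separating_functional hclosed hconv
    ⟨0, hK0, map_zero _⟩ (by
      rintro c hc _ ⟨p, hp, rfl⟩
      exact ⟨c • p, hKcone c hc p hp, map_smul _ _ _⟩) hnot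
  obtain ⟨W, hW⟩ := exists_trace_repr f.toLinearMap
  replace hW : ∀ M, f M = (W * M).trace.re := hW
  have hfK : ∀ P ∈ multiplierCone n full, ∀ R : Matrix _ _ ℂ, R.PosSemidef →
      0 ≤ (W * (kypOp A B P + R)).trace.re := fun P hP R hR => by
    rw [← hW]
    exact hf _ ⟨(P, R), ⟨hP, hR⟩, rfl⟩
  -- On Hermitian matrices `W` and its Hermitian part define the same functional, so `W` may be
  -- replaced by `Z = W + Wᴴ` at the cost of a factor `2`.
  have hherm : ∀ M : Matrix (Fin n ⊕ Fin m) (Fin n ⊕ Fin m) ℂ, M.IsHermitian →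
      ((W + Wᴴ) * M).trace.re = 2 * (W * M).trace.re := fun M hM => by
    rw [Matrix.add_mul, trace_add, Complex.add_re, trace_mul_comm Wᴴ]
    nth_rewrite 2 [← hM.eq]
    rw [← conjTranspose_mul, re_trace_conjTranspose]
    ring
  have hZ : (W + Wᴴ).PosSemidef := posSemidef_iff_quad.2
    ⟨isHermitian_add_transpose_self W, fun x => by
      have := hfK 0 hK0.1 _ (posSemidef_vecMulVec_self_star x)
      rw [show kypOp A B 0 = 0 by simp [kypOp], zero_add, trace_mul_vecMulVec_star] at this
      rw [quad_add, quad_conjTranspose]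
      exact add_nonneg this this⟩
  set Z := W + Wᴴ
  set F : Matrix (Fin n) (Fin n ⊕ Fin m) ℂ := fromCols A B with hF
  set H : Matrix (Fin n) (Fin n ⊕ Fin m) ℂ := statePart n m with hH
  have hop : ∀ P ∈ multiplierCone n full, 0 ≤ ((H * Z * Fᴴ) * P).trace.re := fun P hP => by
    have h1 := hfK P hP 0 PosSemidef.zero
    rw [add_zero] at h1
    have h2 := hherm _ (isHermitian_kypOp (A := A) (B := B) P)
    have h3 : (Z * kypOp A B P).trace.re = 2 * ((H * Z * Fᴴ) * P).trace.re := by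
      have e1 : (Z * (Fᴴ * P * H)).trace = ((H * Z * Fᴴ) * P).trace := by
        rw [← Matrix.mul_assoc, trace_mul_comm, ← Matrix.mul_assoc, ← Matrix.mul_assoc]
      have e2 : (Z * (Hᴴ * Pᴴ * F)).trace.re = ((H * Z * Fᴴ) * P).trace.re := by
        rw [← e1, ← re_trace_conjTranspose, conjTranspose_mul, hZ.1.eq, trace_mul_comm]
        simp only [conjTranspose_mul, conjTranspose_conjTranspose, Matrix.mul_assoc]
      rw [kypOp, Matrix.mul_add, trace_add, Complex.add_re, ← hF, ← hH, e1, e2]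
      ring
    linarith
  set T := H * Z * Fᴴ with hT
  -- Both `x x^*` and `-x x^*` are admissible multipliers, being Hermitian, so `Re (x^* T x)`
  -- vanishes for every `x`.
  have hTT : T + Tᴴ = 0 := by
    refine add_conjTranspose_eq_zero_of_quad fun x => le_antisymm ?_ ?_
    · have h := hop (-vecMulVec x (star x)) ⟨?_, fun _ => ?_⟩
      · rw [Matrix.mul_neg, trace_neg, trace_mul_vecMulVec_star, Complex.neg_re] at h
        exact neg_nonneg.1 h
      · rw [conjTranspose_neg, conjTranspose_vecMulVec, star_star, sub_self, smul_zero]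
        exact PosSemidef.zero
      · rw [IsHermitian, conjTranspose_neg, conjTranspose_vecMulVec, star_star]
    · have h := hop (vecMulVec x (star x)) ⟨?_, fun _ => ?_⟩
      · rwa [trace_mul_vecMulVec_star] at h
      · rw [conjTranspose_vecMulVec, star_star, sub_self, smul_zero]
        exact PosSemidef.zero
      · rw [IsHermitian, conjTranspose_vecMulVec, star_star]
  have hTh : Tᴴ = F * Z * Hᴴ := by
    rw [hT, conjTranspose_mul, conjTranspose_mul, conjTranspose_conjTranspose, hZ.1.eq,
      Matrix.mul_assoc]
  have hTneg : Tᴴ = -T := by rw [eq_neg_iff_add_eq_zero, add_comm, hTT]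
  have hS : (Complex.I • T).IsHermitian := by
    rw [IsHermitian, conjTranspose_smul, hTneg]
    simp
  -- On the half axis `j x x^*` is admissible as well (`X = 0`, `Y = x x^*`), which fixes the sign
  -- of `jT` and later keeps only frequencies `ω ≥ 0`.
  have hSpos : ¬ full → (Complex.I • T).PosSemidef := fun hf => posSemidef_iff_quad.2 ⟨hS, fun x => by
    have h := hop (Complex.I • vecMulVec x (star x)) ⟨?_, fun h => (hf h).elim⟩
    · rw [Matrix.mul_smul, ← Matrix.smul_mul, trace_mul_vecMulVec_star] at h
      exact h
    · have e : (-Complex.I) • (Complex.I • vecMulVec x (star x) -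
          (Complex.I • vecMulVec x (star x))ᴴ) = vecMulVec x (star x) + vecMulVec x (star x) := by
        rw [conjTranspose_smul, conjTranspose_vecMulVec, star_star, smul_sub, smul_smul, smul_smul]
        simp
      rw [e]
      exact (posSemidef_vecMulVec_self_star x).add (posSemidef_vecMulVec_self_star x)⟩
  obtain ⟨V, hV⟩ := exists_eq_mul_conjTranspose hZ
  -- Since `Z = V Vᴴ`, this trace is that of `Z Q`. Applied to `F V` and `H V`, the splitting yields
  -- vectors `V v` that solve the state equation or have zero state.
  have hfin : (Vᴴ * Q * V).trace.re ≤ 0 := by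
    refine re_trace_nonpos (full := full) (F := F * V) (H := H * V) hS ?_ hSpos ?_ ?_
    · have e : F * V * (H * V)ᴴ = F * Z * Hᴴ := by
        rw [hV, conjTranspose_mul]
        simp only [Matrix.mul_assoc]
      rw [e, ← hTh, hTneg, smul_smul]
      simp
    · intro v ω hω hv
      rw [quad_conj]
      refine hfdi _ ω hω ?_
      rw [← mulVec_mulVec, ← mulVec_mulVec, hH, statePart_mulVec] at hv
      exact hv
    · intro v hv
      rw [quad_conj]
      refine hinf _ ?_
      rw [← mulVec_mulVec, hH, statePart_mulVec] at hv
      exact hv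
  rw [trace_mul_comm, ← Matrix.mul_assoc, ← hV, hherm Q hQ, ← hW] at hfin
  rw [map_neg] at hfQ
  linarith

end KYP

/-! ### Realizations -/

section Realization

variable {n m : ℕ}

lemma charmatrix_map_algebraMap (A : Matrix (Fin n) (Fin n) ℝ) :
    (algebraMap (Polynomial ℝ) (RatFunc ℝ)).mapMatrix A.charmatrix =
      Matrix.scalar (Fin n) (RatFunc.X : RatFunc ℝ) - A.map RatFunc.C := by
  ext i j
  by_cases h : i = j
  · subst h; simp [RatFunc.algebraMap_X, RatFunc.algebraMap_C]
  · simp [h, charmatrix_apply_ne, RatFunc.algebraMap_C]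

lemma isUnit_det_scalar_X_sub (A : Matrix (Fin n) (Fin n) ℝ) :
    IsUnit (Matrix.scalar (Fin n) (RatFunc.X : RatFunc ℝ) - A.map RatFunc.C).det := by
  rw [← charmatrix_map_algebraMap, ← RingHom.map_det, isUnit_iff_ne_zero]
  exact RatFunc.algebraMap_ne_zero A.charpoly_monic.ne_zero

/-- The numerator of a transfer matrix over the characteristic polynomial. -/
noncomputable def numeratorMatrix (A : Matrix (Fin n) (Fin n) ℝ) (B : Matrix (Fin n) (Fin m) ℝ)
    (C : Matrix (Fin m) (Fin n) ℝ) (D : Matrix (Fin m) (Fin m) ℝ) :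
    Matrix (Fin m) (Fin m) (Polynomial ℝ) :=
  C.map Polynomial.C * A.charmatrix.adjugate * B.map Polynomial.C
    + A.charpoly • D.map Polynomial.C

lemma map_smul_ringHom {R S k l : Type*} [Semiring R] [Semiring S] (f : R →+* S) (c : R)
    (M : Matrix k l R) : (c • M).map f = f c • M.map f := by
  ext i j
  simp

variable {G : RationalMatrix m} {A : Matrix (Fin n) (Fin n) ℝ} {B : Matrix (Fin n) (Fin m) ℝ}
  {C : Matrix (Fin m) (Fin n) ℝ} {D : Matrix (Fin m) (Fin m) ℝ}

lemma charpoly_smul_eq_numeratorMatrix (h : IsRealization G A B C D) :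
    algebraMap (Polynomial ℝ) (RatFunc ℝ) A.charpoly • G =
      (numeratorMatrix A B C D).map (algebraMap (Polynomial ℝ) (RatFunc ℝ)) := by
  have hC : ∀ {k l : ℕ} (M : Matrix (Fin k) (Fin l) ℝ),
      (M.map Polynomial.C).map (algebraMap (Polynomial ℝ) (RatFunc ℝ)) = M.map RatFunc.C := by
    intro k l M
    ext i j
    simp [RatFunc.algebraMap_C]
  have hadj : A.charmatrix.adjugate.map (algebraMap (Polynomial ℝ) (RatFunc ℝ)) =
      (Matrix.scalar (Fin n) (RatFunc.X : RatFunc ℝ) - A.map RatFunc.C).adjugate := by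
    rw [← charmatrix_map_algebraMap, ← RingHom.map_adjugate]
    rfl
  have hdet : algebraMap (Polynomial ℝ) (RatFunc ℝ) A.charpoly =
      (Matrix.scalar (Fin n) (RatFunc.X : RatFunc ℝ) - A.map RatFunc.C).det := by
    rw [← charmatrix_map_algebraMap, ← RingHom.map_det]
    rfl
  have hu := isUnit_det_scalar_X_sub A
  rw [h, numeratorMatrix, Matrix.map_add _ (map_add _), Matrix.map_mul, Matrix.map_mul, hC, hC, hadj,
    map_smul_ringHom, hC, hdet, smul_add]
  congr 1
  rw [Matrix.inv_def, Matrix.mul_smul, Matrix.smul_mul, smul_smul, Ring.mul_inverse_cancel _ hu,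
    one_smul]

/-- Clearing denominators moves the realization identity into `ℝ[X]`, where it can be evaluated at
complex points and compared coefficient by coefficient. -/
lemma num_mul_charpoly (h : IsRealization G A B C D) (i k : Fin m) :
    (G i k).num * A.charpoly = numeratorMatrix A B C D i k * (G i k).denom := by
  have h1 := congrFun (congrFun (charpoly_smul_eq_numeratorMatrix h) i) k
  rw [Matrix.smul_apply, Matrix.map_apply, smul_eq_mul] at h1
  apply RatFunc.algebraMap_injective ℝ
  have hd : algebraMap (Polynomial ℝ) (RatFunc ℝ) (G i k).denom ≠ 0 :=
    RatFunc.algebraMap_ne_zero (RatFunc.denom_ne_zero _)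
  have h2 := RatFunc.num_div_denom (G i k)
  rw [div_eq_iff hd] at h2
  rw [map_mul, map_mul, ← h1, h2]
  ring

lemma denom_dvd_charpoly (h : IsRealization G A B C D) (i k : Fin m) :
    (G i k).denom ∣ A.charpoly := by
  rw [RatFunc.denom_dvd A.charpoly_monic.ne_zero]
  refine ⟨numeratorMatrix A B C D i k, ?_⟩
  have h1 := congrFun (congrFun (charpoly_smul_eq_numeratorMatrix h) i) k
  rw [Matrix.smul_apply, Matrix.map_apply, smul_eq_mul] at h1
  rw [← h1, mul_div_cancel_left₀]
  exact RatFunc.algebraMap_ne_zero A.charpoly_monic.ne_zero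

lemma not_isPole_of_charpoly_ne_zero (h : IsRealization G A B C D) {s : ℂ}
    (hs : Polynomial.aeval s A.charpoly ≠ 0) : ¬ IsPole G s := by
  rintro ⟨i, k, hik⟩
  obtain ⟨q, hq⟩ := denom_dvd_charpoly h i k
  rw [hq, map_mul, hik, zero_mul] at hs
  exact hs rfl

lemma charmatrix_map_aeval (A : Matrix (Fin n) (Fin n) ℝ) (s : ℂ) :
    (Polynomial.aeval s : Polynomial ℝ →ₐ[ℝ] ℂ).toRingHom.mapMatrix A.charmatrix =
      Matrix.scalar (Fin n) s - toComplexMatrix A := by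
  ext i j
  by_cases h : i = j
  · subst h; simp
  · simp [h, charmatrix_apply_ne]

/-- Away from the eigenvalues of `A`, the value of `G` is computed by solving the state equation. -/
lemma valueAt_mulVec (h : IsRealization G A B C D) {s : ℂ}
    (hs : Polynomial.aeval s A.charpoly ≠ 0) {x : Fin n → ℂ} {u : Fin m → ℂ}
    (hx : toComplexMatrix A *ᵥ x + toComplexMatrix B *ᵥ u = s • x) :
    valueAt G (s : OnePoint ℂ) *ᵥ u = toComplexMatrix C *ᵥ x + toComplexMatrix D *ᵥ u := by
  set φ : Polynomial ℝ →+* ℂ := (Polynomial.aeval s : Polynomial ℝ →ₐ[ℝ] ℂ).toRingHom with hφ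
  have hφs : φ A.charpoly ≠ 0 := hs
  have hval : φ A.charpoly • valueAt G (s : OnePoint ℂ) = (numeratorMatrix A B C D).map φ := by
    ext i k
    have h1 := congrArg φ (num_mul_charpoly h i k)
    rw [map_mul, map_mul] at h1
    have hd : φ (G i k).denom ≠ 0 := fun h0 => not_isPole_of_charpoly_ne_zero h hs ⟨i, k, h0⟩
    have e : valueAt G (s : OnePoint ℂ) i k = φ (G i k).num / φ (G i k).denom := rfl
    rw [Matrix.smul_apply, e, smul_eq_mul, Matrix.map_apply, mul_div_assoc', div_eq_iff hd, ← h1,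
      mul_comm]
  have hC : ∀ {k l : ℕ} (M : Matrix (Fin k) (Fin l) ℝ),
      (M.map Polynomial.C).map φ = toComplexMatrix M := by
    intro k l M
    ext i j
    simp [hφ]
  have hadj : A.charmatrix.adjugate.map φ =
      (Matrix.scalar (Fin n) s - toComplexMatrix A).adjugate := by
    rw [← charmatrix_map_aeval, ← RingHom.map_adjugate]
    rfl
  have hdet : φ A.charpoly = (Matrix.scalar (Fin n) s - toComplexMatrix A).det := by
    rw [← charmatrix_map_aeval, ← RingHom.map_det]
    rfl
  have hBu : toComplexMatrix B *ᵥ u = (Matrix.scalar (Fin n) s - toComplexMatrix A) *ᵥ x := by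
    rw [sub_mulVec, eq_sub_iff_add_eq, add_comm, hx]
    ext i
    simp [mulVec_diagonal]
  have hsolve : (Matrix.scalar (Fin n) s - toComplexMatrix A).adjugate *ᵥ
      (toComplexMatrix B *ᵥ u) = φ A.charpoly • x := by
    rw [hBu, mulVec_mulVec, adjugate_mul, ← hdet, smul_mulVec, one_mulVec]
  have hnum : (numeratorMatrix A B C D).map φ *ᵥ u =
      φ A.charpoly • (toComplexMatrix C *ᵥ x + toComplexMatrix D *ᵥ u) := by
    rw [numeratorMatrix, Matrix.map_add _ (map_add _), Matrix.map_mul, Matrix.map_mul, hC, hC, hadj,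
      map_smul_ringHom, hC, add_mulVec, ← mulVec_mulVec, ← mulVec_mulVec, hsolve,
      mulVec_smul, smul_mulVec, smul_add]
  rw [← hval, smul_mulVec] at hnum
  exact smul_right_injective _ hφs hnum

/-- Viewed as a polynomial with matrix coefficients, the adjugate times the monic `X - A` is the
characteristic polynomial, of degree `n`; so a nonzero adjugate has degree below `n`. This makes `C
(sI - A)⁻¹ B` strictly proper. -/
lemma coeff_adjugate_charmatrix (A : Matrix (Fin n) (Fin n) ℝ) {k : ℕ} (hk : n ≤ k) (i j : Fin n) :
    (A.charmatrix.adjugate i j).coeff k = 0 := by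
  have : Nonempty (Fin n) := ⟨i⟩
  rw [← matPolyEquiv_coeff_apply]
  set q := matPolyEquiv A.charmatrix.adjugate with hq
  have h1 : (Polynomial.X - Polynomial.C A) * q =
      A.charpoly.map (algebraMap ℝ (Matrix (Fin n) (Fin n) ℝ)) := by
    rw [hq, ← matPolyEquiv_charmatrix, ← map_mul, mul_adjugate, ← matPolyEquiv_smul_one]
    rfl
  by_cases hq0 : q = 0
  · simp [hq0]
  have h2 := (Polynomial.monic_X_sub_C A).natDegree_mul' hq0
  rw [h1, Polynomial.natDegree_X_sub_C] at h2
  have h3 : (A.charpoly.map (algebraMap ℝ (Matrix (Fin n) (Fin n) ℝ))).natDegree ≤ n :=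
    Polynomial.natDegree_map_le.trans (by rw [A.charpoly_natDegree_eq_dim, Fintype.card_fin])
  rw [Polynomial.coeff_eq_zero_of_natDegree_lt (by omega)]
  rfl

lemma coeff_numeratorMatrix {k : ℕ} (hk : n ≤ k) (i j : Fin m) :
    (numeratorMatrix A B C D i j).coeff k = A.charpoly.coeff k * D i j := by
  simp [numeratorMatrix, Matrix.mul_apply, Polynomial.coeff_C_mul,
    Polynomial.coeff_mul_C, coeff_adjugate_charmatrix A hk, Finset.sum_mul]

/-- Only `D` contributes to the coefficient of degree `n` of the numerator matrix. The claim follows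
by comparing the coefficients of degree `deg denom + n` in `num_mul_charpoly`, both `denom` and the
characteristic polynomial being monic. -/
lemma valueAt_infty (hproper : IsProperRational G) (h : IsRealization G A B C D) :
    valueAt G OnePoint.infty = toComplexMatrix D := by
  have hdeg : A.charpoly.natDegree = n := by rw [A.charpoly_natDegree_eq_dim, Fintype.card_fin]
  ext i k
  have e : valueAt G OnePoint.infty i k = (((G i k).num.coeff (G i k).denom.natDegree : ℝ) : ℂ) :=
    rfl
  rw [e, toComplexMatrix, Matrix.map_apply]
  congr 1
  have h1 := congrArg (fun p => p.coeff ((G i k).denom.natDegree + n)) (num_mul_charpoly h i k)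
  beta_reduce at h1
  have hN : (numeratorMatrix A B C D i k).natDegree ≤ n := by
    refine Polynomial.natDegree_le_iff_coeff_eq_zero.2 fun N hN => ?_
    rw [coeff_numeratorMatrix hN.le, Polynomial.coeff_eq_zero_of_natDegree_lt (by omega), zero_mul]
  have hlead : A.charpoly.coeff n = 1 := by
    have := A.charpoly_monic.coeff_natDegree
    rwa [hdeg] at this
  rw [Polynomial.coeff_mul_add_eq_of_natDegree_le (hproper i k) hdeg.le, mul_comm (numeratorMatrix _ _ _ _ _ _),
    Polynomial.coeff_mul_add_eq_of_natDegree_le le_rfl hN, coeff_numeratorMatrix le_rfl, hlead,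
    (RatFunc.monic_denom _).coeff_natDegree] at h1
  simpa using h1

/-- Compressing a realization to an `A`-invariant subspace that contains the range of `B`. -/
lemma isRealization_of_intertwining {r : ℕ} (h : IsRealization G A B C D)
    {T : Matrix (Fin n) (Fin r) ℝ} {A' : Matrix (Fin r) (Fin r) ℝ} {B' : Matrix (Fin r) (Fin m) ℝ}
    (hA : A * T = T * A') (hB : B = T * B') : IsRealization G A' B' (C * T) D := by
  have hu := isUnit_det_scalar_X_sub A
  have hu' := isUnit_det_scalar_X_sub A'
  set R := Matrix.scalar (Fin n) (RatFunc.X : RatFunc ℝ) - A.map RatFunc.C with hR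
  set R' := Matrix.scalar (Fin r) (RatFunc.X : RatFunc ℝ) - A'.map RatFunc.C with hR'
  have e1 : R * T.map RatFunc.C = T.map RatFunc.C * R' := by
    rw [hR, hR', Matrix.sub_mul, Matrix.mul_sub, ← Matrix.map_mul, ← Matrix.map_mul, hA]
    congr 1
    ext i j
    simp [Matrix.scalar_apply, mul_comm]
  have e2 : R⁻¹ * T.map RatFunc.C = T.map RatFunc.C * R'⁻¹ := by
    have := congrArg (fun M => R⁻¹ * M * R'⁻¹) e1
    beta_reduce at this
    rw [← Matrix.mul_assoc, nonsing_inv_mul _ hu, Matrix.one_mul, Matrix.mul_assoc, Matrix.mul_assoc,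
      mul_nonsing_inv _ hu', Matrix.mul_one] at this
    exact this.symm
  rw [IsRealization, h, hB, Matrix.map_mul, Matrix.map_mul, ← hR, ← hR', Matrix.mul_assoc,
    ← Matrix.mul_assoc R⁻¹, e2]
  simp only [Matrix.mul_assoc]

/-- In a basis of `V`, the restriction of the system to `V` realizes the same `G` with dimension
`dim V`, so minimality forces `n ≤ dim V`. -/
lemma eq_top_of_isMinimalRealization (h : IsMinimalRealization G A B C D)
    (V : Submodule ℝ (Fin n → ℝ)) (hB : ∀ u, B *ᵥ u ∈ V) (hA : ∀ x ∈ V, A *ᵥ x ∈ V) : V = ⊤ := by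
  let b := Module.finBasis ℝ V
  have hb : ∀ v : V, (v : Fin n → ℝ) = ∑ i, b.repr v i • (b i : Fin n → ℝ) := fun v => by
    have := congrArg Subtype.val (b.sum_repr v).symm
    simpa only [Submodule.coe_sum, Submodule.coe_smul] using this
  have hreal := isRealization_of_intertwining h.1
    (T := Matrix.of fun i j => (b j : Fin n → ℝ) i)
    (A' := Matrix.of fun i j => b.repr ⟨A *ᵥ (b j : Fin n → ℝ), hA _ (b j).2⟩ i)
    (B' := Matrix.of fun i j => b.repr ⟨B *ᵥ Pi.single j 1, hB _⟩ i) (by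
      ext i j
      have := congrFun (hb ⟨A *ᵥ (b j : Fin n → ℝ), hA _ (b j).2⟩) i
      simp only [Finset.sum_apply, Pi.smul_apply, smul_eq_mul] at this
      rw [Matrix.mul_apply', Matrix.mul_apply]
      refine this.trans (Finset.sum_congr rfl fun l _ => mul_comm _ _)) (by
      ext i j
      have := congrFun (hb ⟨B *ᵥ Pi.single j 1, hB _⟩) i
      simp only [Finset.sum_apply, Pi.smul_apply, smul_eq_mul, mulVec_single_one, col_apply] at this
      rw [Matrix.mul_apply]
      refine this.trans (Finset.sum_congr rfl fun l _ => ?_)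
      simp [mul_comm])
  have hn := h.2 _ _ _ _ _ hreal
  apply Submodule.eq_top_of_finrank_eq
  refine le_antisymm (Submodule.finrank_le V) ?_
  simpa using hn

/-- Minimality only concerns real subspaces. The real vectors in a complex invariant subspace form a
real invariant subspace, hence are all of `ℝ^n`, and these span `ℂ^n` over `ℂ`. -/
lemma isControllablePair_of_isMinimalRealization (h : IsMinimalRealization G A B C D) :
    IsControllablePair (toComplexMatrix A) (toComplexMatrix B) := by
  intro V hB hA
  have hmul : ∀ {k l : ℕ} (M : Matrix (Fin k) (Fin l) ℝ) (x : Fin l → ℝ),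
      (fun i => ((M *ᵥ x) i : ℂ)) = toComplexMatrix M *ᵥ fun i => (x i : ℂ) := by
    intro k l M x
    ext i
    simp [mulVec, dotProduct]
  let W : Submodule ℝ (Fin n → ℝ) :=
    { carrier := {x | (fun i => (x i : ℂ)) ∈ V}
      add_mem' := fun {x y} hx hy => by
        have e : (fun i => ((x + y) i : ℂ)) = (fun i => (x i : ℂ)) + fun i => (y i : ℂ) := by
          ext i; simp
        change _ ∈ V
        rw [e]
        exact V.add_mem hx hy
      zero_mem' := by
        change (fun i => ((0 : ℝ) : ℂ)) ∈ V
        simp only [Complex.ofReal_zero]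
        exact V.zero_mem
      smul_mem' := fun c x hx => by
        have e : (fun i => ((c • x) i : ℂ)) = (c : ℂ) • fun i => (x i : ℂ) := by
          ext i; simp
        change _ ∈ V
        rw [e]
        exact V.smul_mem _ hx }
  have hW : W = ⊤ := by
    refine eq_top_of_isMinimalRealization h W (fun u => ?_) (fun x hx => ?_)
    · change _ ∈ V
      rw [hmul]
      exact hB _
    · change _ ∈ V
      rw [hmul]
      exact hA _ hx
  have hreal : ∀ x : Fin n → ℝ, (fun i => (x i : ℂ)) ∈ V := fun x => by
    have : x ∈ W := by rw [hW]; trivial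
    exact this
  refine Submodule.eq_top_iff'.2 fun z => ?_
  have e : z = (fun i => ((z i).re : ℂ)) + Complex.I • fun i => ((z i).im : ℂ) := by
    ext i
    simp [mul_comm Complex.I, Complex.re_add_im]
  rw [e]
  exact V.add_mem (hreal fun i => (z i).re) (V.smul_mem _ (hreal fun i => (z i).im))

end Realization

/-! ### Matrix inequalities and frequency domain inequalities -/

/-- The numerical range of `M` lies in the half plane `Re (e^{-jη} z) ≥ 0`. -/
def InHalfPlane {m : ℕ} (η : ℝ) (M : Matrix (Fin m) (Fin m) ℂ) : Prop :=
  ∀ u, 0 ≤ (Complex.exp (-(η * Complex.I)) * (star u ⬝ᵥ M *ᵥ u)).re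

section FDI

variable {n m : ℕ} {G : RationalMatrix m} {A : Matrix (Fin n) (Fin n) ℝ}
  {B : Matrix (Fin n) (Fin m) ℝ} {C : Matrix (Fin m) (Fin n) ℝ} {D : Matrix (Fin m) (Fin m) ℝ}
  {η : ℝ}

lemma toComplexMatrix_transpose {k l : ℕ} (M : Matrix (Fin k) (Fin l) ℝ) :
    toComplexMatrix Mᵀ = (toComplexMatrix M)ᴴ := by
  ext i j
  simp

lemma transpose_toComplexMatrix {k l : ℕ} (M : Matrix (Fin k) (Fin l) ℝ) :
    (toComplexMatrix M)ᵀ = (toComplexMatrix M)ᴴ := by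
  ext i j
  simp

lemma star_exp (η : ℝ) : star (Complex.exp (η * Complex.I)) = Complex.exp (-(η * Complex.I)) := by
  rw [Complex.star_def, ← Complex.exp_conj]
  simp

lemma star_exp_neg (η : ℝ) :
    star (Complex.exp (-(η * Complex.I))) = Complex.exp (η * Complex.I) := by
  rw [← star_exp, star_star]

lemma isHermitian_sectorM (C : Matrix (Fin m) (Fin n) ℝ) (D : Matrix (Fin m) (Fin m) ℝ) (η : ℝ) :
    (sectorM C D η).IsHermitian := by
  rw [IsHermitian, sectorM, fromBlocks_conjTranspose]
  simp only [conjTranspose_zero, conjTranspose_neg, conjTranspose_smul, conjTranspose_sub, star_exp,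
    star_exp_neg, toComplexMatrix_transpose, conjTranspose_conjTranspose]
  congr 1
  abel

lemma kypOp_eq_fromBlocks (A : Matrix (Fin n) (Fin n) ℂ) (B : Matrix (Fin n) (Fin m) ℂ)
    (P : Matrix (Fin n) (Fin n) ℂ) :
    kypOp A B P = fromBlocks (Aᴴ * P + Pᴴ * A) (Pᴴ * B) (Bᴴ * P) 0 := by
  rw [kypOp, conjTranspose_fromCols_eq_fromRows_conjTranspose,
    conjTranspose_fromCols_eq_fromRows_conjTranspose, fromRows_mul, fromRows_mul _ _ Pᴴ,
    fromRows_mul_fromCols, fromRows_mul_fromCols, fromBlocks_add]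
  simp

lemma sandwich_eq_kypOp (A : Matrix (Fin n) (Fin n) ℝ) (B : Matrix (Fin n) (Fin m) ℝ)
    (P : Matrix (Fin n) (Fin n) ℂ) :
    (toComplexMatrix (Matrix.fromBlocks A B (1 : Matrix (Fin n) (Fin n) ℝ) 0)).transpose
      * Matrix.fromBlocks 0 P Pᴴ 0
      * toComplexMatrix (Matrix.fromBlocks A B (1 : Matrix (Fin n) (Fin n) ℝ) 0) =
    kypOp (toComplexMatrix A) (toComplexMatrix B) P := by
  have e : toComplexMatrix (Matrix.fromBlocks A B (1 : Matrix (Fin n) (Fin n) ℝ) 0) =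
      fromBlocks (toComplexMatrix A) (toComplexMatrix B) 1 0 := by
    rw [toComplexMatrix, fromBlocks_map, Matrix.map_one _ Complex.ofReal_zero Complex.ofReal_one,
      Matrix.map_zero _ Complex.ofReal_zero]
  rw [e, fromBlocks_transpose, transpose_toComplexMatrix, transpose_toComplexMatrix,
    fromBlocks_multiply, fromBlocks_multiply, kypOp_eq_fromBlocks]
  simp [add_comm]

lemma satisfiesSectorLMI_iff {X Y : Matrix (Fin n) (Fin n) ℂ} (hX : X.IsHermitian)
    (hY : Y.IsHermitian) :
    SatisfiesSectorLMI A B C D η X Y ↔ Y.PosSemidef ∧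
      (-(kypOp (toComplexMatrix A) (toComplexMatrix B) (X + Complex.I • Y)
        + sectorM C D η)).PosSemidef := by
  have e : (X + Complex.I • Y)ᴴ = X - Complex.I • Y := by
    rw [conjTranspose_add, conjTranspose_smul, hX.eq, hY.eq]
    simp [sub_eq_add_neg]
  rw [SatisfiesSectorLMI, ← e, sandwich_eq_kypOp]
  simp [hX, hY]

/-- The witnesses are the Hermitian components `X = (P + Pᴴ)/2` and `Y = (P - Pᴴ)/(2j)` of `P = X +
jY`. -/
lemma exists_satisfiesSectorLMI_of_multiplier {full : Prop} {P : Matrix (Fin n) (Fin n) ℂ}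
    (hP : P ∈ multiplierCone n full)
    (h : (-(kypOp (toComplexMatrix A) (toComplexMatrix B) P + sectorM C D η)).PosSemidef) :
    ∃ X Y, SatisfiesSectorLMI A B C D η X Y := by
  have hY := hP.1.smul (show (0 : ℂ) ≤ ((1 / 2 : ℝ) : ℂ) by
    exact_mod_cast (by norm_num : (0 : ℝ) ≤ 1 / 2))
  have hX : (((1 / 2 : ℝ) : ℂ) • (P + Pᴴ)).IsHermitian := by
    rw [IsHermitian, conjTranspose_smul, conjTranspose_add, conjTranspose_conjTranspose, add_comm,
      Complex.star_def, Complex.conj_ofReal]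
  refine ⟨_, _, (satisfiesSectorLMI_iff hX hY.1).2 ⟨hY, ?_⟩⟩
  have e : ((1 / 2 : ℝ) : ℂ) • (P + Pᴴ) +
      Complex.I • ((1 / 2 : ℝ) : ℂ) • (-Complex.I) • (P - Pᴴ) = P := by
    ext i j
    simp only [Matrix.add_apply, Matrix.smul_apply, Matrix.sub_apply, smul_eq_mul]
    push_cast
    linear_combination (-(1 / 2) * (P i j - Pᴴ i j)) * Complex.I_mul_I
  rw [e]
  exact h

lemma quad_sectorM (C : Matrix (Fin m) (Fin n) ℝ) (D : Matrix (Fin m) (Fin m) ℝ) (η : ℝ)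
    (v : Fin n ⊕ Fin m → ℂ) :
    quad (sectorM C D η) v = -2 * (Complex.exp (-(η * Complex.I)) * (star (v ∘ Sum.inr) ⬝ᵥ
      (toComplexMatrix C *ᵥ (v ∘ Sum.inl) + toComplexMatrix D *ᵥ (v ∘ Sum.inr)))).re := by
  set K : Matrix (Fin n ⊕ Fin m) (Fin n ⊕ Fin m) ℂ :=
    fromBlocks 0 0 (-(Complex.exp (-(η * Complex.I)) • toComplexMatrix C))
      (-(Complex.exp (-(η * Complex.I)) • toComplexMatrix D)) with hK
  have e : sectorM C D η = K + Kᴴ := by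
    rw [hK, fromBlocks_conjTranspose, fromBlocks_add, sectorM]
    simp only [conjTranspose_zero, conjTranspose_neg, conjTranspose_smul, star_exp_neg,
      toComplexMatrix_transpose]
    simp [sub_eq_add_neg]
  have e2 : star v ⬝ᵥ K *ᵥ v = -(Complex.exp (-(η * Complex.I)) * (star (v ∘ Sum.inr) ⬝ᵥ
      (toComplexMatrix C *ᵥ (v ∘ Sum.inl) + toComplexMatrix D *ᵥ (v ∘ Sum.inr)))) := by
    rw [hK, fromBlocks_mulVec]
    have hs : ∀ w : Fin m → ℂ, star v ⬝ᵥ Sum.elim (0 : Fin n → ℂ) w = star (v ∘ Sum.inr) ⬝ᵥ w := by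
      intro w
      simp [dotProduct]
    simp only [zero_mulVec, add_zero]
    rw [hs, neg_mulVec, neg_mulVec, smul_mulVec, smul_mulVec, ← neg_add, ← smul_add,
      dotProduct_neg, dotProduct_smul, smul_eq_mul]
  rw [e, quad_add, quad_conjTranspose, quad, e2, Complex.neg_re]
  ring

/-- Eigenvalues of `A` are finitely many. The neighbourhood is taken to the right of `ω₀` so that
approximating frequencies remain nonnegative when `ω₀` is. -/
lemma eventually_charpoly_ne_zero (A : Matrix (Fin n) (Fin n) ℝ) (ω₀ : ℝ) :
    ∀ᶠ ω in nhdsWithin ω₀ (Set.Ioi ω₀), Polynomial.aeval (jw ω) A.charpoly ≠ 0 := by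
  have hfin : {ω : ℝ | Polynomial.aeval (jw ω) A.charpoly = 0}.Finite := by
    have h1 : {s : ℂ | Polynomial.aeval s A.charpoly = 0}.Finite := by
      refine (A.charpoly.rootSet_finite ℂ).subset fun s hs => ?_
      exact (Polynomial.mem_rootSet_of_ne A.charpoly_monic.ne_zero).2 hs
    refine h1.preimage (f := jw) fun a _ b _ hab => ?_
    simpa [jw] using hab
  have h2 := (hfin.subset Set.sdiff_subset : ({ω : ℝ | Polynomial.aeval (jw ω) A.charpoly = 0} \
    {ω₀}).Finite).isClosed.isOpen_compl.mem_nhds (x := ω₀) (by simp)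
  filter_upwards [mem_nhdsWithin_of_mem_nhds h2, self_mem_nhdsWithin] with ω hω hlt h0
  exact hω ⟨h0, ne_of_gt hlt⟩

/-- Away from the eigenvalues of `A`, the form of `sectorM` on the solutions of the state equation is
given by the value of `G`. -/
lemma quad_sectorM_eq (h : IsRealization G A B C D) {ω : ℝ}
    (hω : Polynomial.aeval (jw ω) A.charpoly ≠ 0) {v : Fin n ⊕ Fin m → ℂ}
    (hv : fromCols (toComplexMatrix A) (toComplexMatrix B) *ᵥ v =
      (Complex.I * ω) • (v ∘ Sum.inl)) :
    quad (sectorM C D η) v = -2 * (Complex.exp (-(η * Complex.I)) * (star (v ∘ Sum.inr) ⬝ᵥ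
      valueAt G (jw ω : ℂ) *ᵥ (v ∘ Sum.inr))).re := by
  rw [fromCols_mulVec] at hv
  rw [quad_sectorM, ← valueAt_mulVec h hω hv]

lemma exists_state_eq (A : Matrix (Fin n) (Fin n) ℝ) (B : Matrix (Fin n) (Fin m) ℝ) {s : ℂ}
    (hs : Polynomial.aeval s A.charpoly ≠ 0) (u : Fin m → ℂ) :
    ∃ x : Fin n → ℂ, toComplexMatrix A *ᵥ x + toComplexMatrix B *ᵥ u = s • x := by
  have hdet : Polynomial.aeval s A.charpoly = (Matrix.scalar (Fin n) s - toComplexMatrix A).det := by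
    rw [← charmatrix_map_aeval, ← RingHom.map_det]
    rfl
  rw [hdet] at hs
  refine ⟨(Matrix.scalar (Fin n) s - toComplexMatrix A)⁻¹ *ᵥ (toComplexMatrix B *ᵥ u), ?_⟩
  set x := (Matrix.scalar (Fin n) s - toComplexMatrix A)⁻¹ *ᵥ (toComplexMatrix B *ᵥ u) with hx
  have h1 : (Matrix.scalar (Fin n) s - toComplexMatrix A) *ᵥ x = toComplexMatrix B *ᵥ u := by
    rw [hx, mulVec_mulVec, mul_nonsing_inv _ (isUnit_iff_ne_zero.2 hs), one_mulVec]
  rw [← h1, sub_mulVec, add_sub_cancel]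
  ext i
  simp [mulVec_diagonal]

lemma inHalfPlane_of_lmi_of_charpoly_ne_zero (h : IsRealization G A B C D)
    {X Y : Matrix (Fin n) (Fin n) ℂ} (hL : SatisfiesSectorLMI A B C D η X Y) {ω : ℝ} (h0 : 0 ≤ ω)
    (hω : Polynomial.aeval (jw ω) A.charpoly ≠ 0) : InHalfPlane η (valueAt G (jw ω : ℂ)) := by
  have hX := hL.1
  have hY := hL.2.1
  obtain ⟨hYp, hM⟩ := (satisfiesSectorLMI_iff hX hY).1 hL
  intro u
  obtain ⟨x, hx⟩ := exists_state_eq A B hω u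
  have hv : fromCols (toComplexMatrix A) (toComplexMatrix B) *ᵥ (Sum.elim x u) =
      (Complex.I * ω) • (Sum.elim x u ∘ Sum.inl) := by
    rw [fromCols_mulVec]
    exact hx
  have h1 := (posSemidef_iff_quad.1 hM).2 (Sum.elim x u)
  have h2 := quad_kypOp_nonneg (P := X + Complex.I • Y) (by
    have e : (-Complex.I) • ((X + Complex.I • Y) - (X + Complex.I • Y)ᴴ) = Y + Y := by
      rw [conjTranspose_add, conjTranspose_smul, hX.eq, hY.eq]
      ext i j
      simp only [Matrix.add_apply, Matrix.smul_apply, Matrix.sub_apply, smul_eq_mul,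
        Complex.star_def, Complex.conj_I]
      linear_combination (-2 * Y i j) * Complex.I_mul_I
    rw [e]
    exact hYp.add hYp) h0 hv
  have h3 := quad_sectorM_eq (η := η) h hω hv
  rw [quad_neg, quad_add] at h1
  rw [Sum.elim_comp_inr] at h3
  linarith

lemma continuousAt_valueAt {ω₀ : ℝ} (hω : ¬ IsPole G (jw ω₀)) :
    ContinuousAt (fun ω : ℝ => valueAt G (jw ω : ℂ)) ω₀ := by
  refine continuousAt_pi.2 fun i => continuousAt_pi.2 fun k => ?_
  have e : (fun ω : ℝ => valueAt G (jw ω : ℂ) i k) = fun ω : ℝ =>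
    Polynomial.aeval (jw ω) (G i k).num / Polynomial.aeval (jw ω) (G i k).denom := rfl
  rw [e]
  have hj : Continuous jw := by unfold jw; fun_prop
  refine ContinuousAt.div ?_ ?_ fun h => hω ⟨i, k, h⟩
  · exact ((Polynomial.continuous_aeval _).comp hj).continuousAt
  · exact ((Polynomial.continuous_aeval _).comp hj).continuousAt

/-- The matrix inequality implies the frequency domain inequality. -/
theorem inHalfPlane_of_lmi (hproper : IsProperRational G) (h : IsRealization G A B C D)
    {X Y : Matrix (Fin n) (Fin n) ℂ} (hL : SatisfiesSectorLMI A B C D η X Y) {s : OnePoint ℂ}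
    (hs : s ∈ nonnegFrequencies G) : InHalfPlane η (valueAt G s) := by
  rcases hs with ⟨ω₀, h0, hp, rfl⟩ | rfl
  · intro u
    -- A frequency that is not a pole may still be an eigenvalue of `A`, so the inequality is
    -- obtained as a limit from the right.
    have hc : ContinuousAt (fun ω : ℝ => (Complex.exp (-(η * Complex.I)) *
        (star u ⬝ᵥ valueAt G (jw ω : ℂ) *ᵥ u)).re) ω₀ := by
      have hg : Continuous fun M : Matrix (Fin m) (Fin m) ℂ =>
          (Complex.exp (-(η * Complex.I)) * (star u ⬝ᵥ M *ᵥ u)).re := by fun_prop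
      exact hg.continuousAt.comp (continuousAt_valueAt hp)
    refine ge_of_tendsto (hc.tendsto.mono_left
      (nhdsWithin_le_nhds (s := Set.Ioi ω₀))) ?_
    filter_upwards [eventually_charpoly_ne_zero A ω₀, self_mem_nhdsWithin] with ω hω hlt
    exact inHalfPlane_of_lmi_of_charpoly_ne_zero h hL (h0.trans (le_of_lt hlt)) hω u
  · intro u
    rw [valueAt_infty hproper h]
    obtain ⟨-, hM⟩ := (satisfiesSectorLMI_iff hL.1 hL.2.1).1 hL
    -- With zero state the multiplier term vanishes and only the block containing `D` is left.
    have h1 := (posSemidef_iff_quad.1 hM).2 (Sum.elim 0 u)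
    rw [quad_neg, quad_add, quad_sectorM, quad, star_dotProduct_kypOp_mulVec] at h1
    simp at h1
    simpa using h1

/-- Hautus: for a controllable pair `[A - jωI, B]` has full row rank. -/
lemma det_pencil_ne_zero {A : Matrix (Fin n) (Fin n) ℂ} {B : Matrix (Fin n) (Fin m) ℂ}
    (hc : IsControllablePair A B) (s : ℂ) :
    ((fromCols A B - s • statePart n m) * (fromCols A B - s • statePart n m)ᴴ).det ≠ 0 := by
  set K := fromCols A B - s • statePart n m with hK
  intro hdet
  obtain ⟨w, hw, hw0⟩ := exists_mulVec_eq_zero_iff.2 hdet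
  have h1 : Kᴴ *ᵥ w = 0 := by
    have := (conjTranspose_mul_self_mulVec_eq_zero Kᴴ w).1 (by
      rwa [conjTranspose_conjTranspose])
    exact this
  have h2 : ∀ v, star w ⬝ᵥ K *ᵥ v = 0 := fun v => by
    rw [dotProduct_mulVec, ← conjTranspose_conjTranspose K, ← star_mulVec, h1]
    simp
  have hKv : ∀ x u, K *ᵥ Sum.elim x u = A *ᵥ x + B *ᵥ u - s • x := fun x u => by
    rw [hK, sub_mulVec, smul_mulVec, statePart_mulVec, fromCols_mulVec, Sum.elim_comp_inl,
      Sum.elim_comp_inr]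
  -- The hyperplane orthogonal to a left null vector `w` of the pencil contains the range of `B` and
  -- is `A`-invariant. Controllability makes it everything, so `w` is orthogonal to itself.
  let V : Submodule ℂ (Fin n → ℂ) :=
    { carrier := {x | star w ⬝ᵥ x = 0}
      add_mem' := fun {x y} hx hy => by
        change star w ⬝ᵥ (x + y) = 0
        rw [dotProduct_add, show star w ⬝ᵥ x = 0 from hx, show star w ⬝ᵥ y = 0 from hy, add_zero]
      zero_mem' := dotProduct_zero _
      smul_mem' := fun c x hx => by
        change star w ⬝ᵥ (c • x) = 0
        rw [dotProduct_smul, show star w ⬝ᵥ x = 0 from hx, smul_zero] }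
  have hV : V = ⊤ := by
    refine hc V (fun u => ?_) (fun x hx => ?_)
    · have := h2 (Sum.elim 0 u)
      rw [hKv] at this
      rw [mulVec_zero, zero_add, smul_zero, sub_zero] at this
      exact this
    · have := h2 (Sum.elim x 0)
      rw [hKv, mulVec_zero, add_zero, dotProduct_sub, dotProduct_smul,
        show star w ⬝ᵥ x = 0 from hx, smul_zero, sub_zero] at this
      exact this
  have hwV : w ∈ V := by rw [hV]; trivial
  exact hw (dotProduct_star_self_eq_zero.1 (hwV))

/-- The frequency domain inequality implies the matrix inequality. -/
theorem exists_multiplier_of_inHalfPlane {full : Prop} (h : IsRealization G A B C D)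
    (hc : IsControllablePair (toComplexMatrix A) (toComplexMatrix B))
    (hfdi : ∀ ω : ℝ, (¬ full → 0 ≤ ω) → Polynomial.aeval (jw ω) A.charpoly ≠ 0 →
      InHalfPlane η (valueAt G (jw ω : ℂ)))
    (hinf : InHalfPlane η (toComplexMatrix D)) :
    ∃ P ∈ multiplierCone n full,
      (-(kypOp (toComplexMatrix A) (toComplexMatrix B) P + sectorM C D η)).PosSemidef := by
  refine exists_multiplier hc (isHermitian_sectorM C D η) (fun v ω₀ hω₀ hv => ?_) fun v hv => ?_
  · set F := fromCols (toComplexMatrix A) (toComplexMatrix B) with hF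
    set K : ℝ → Matrix (Fin n) (Fin n ⊕ Fin m) ℂ := fun ω => F - jw ω • statePart n m with hK
    -- This is the orthogonal projection of `v` onto the kernel of `K ω`, multiplied by `det (K Kᴴ)`
    -- to remove the inverse. It is continuous in `ω`, always solves the state equation, and at `ω₀`
    -- is a nonzero multiple of `v`; so the inequality at eigenvalues of `A` follows from nearby
    -- frequencies.
    set w : ℝ → Fin n ⊕ Fin m → ℂ := fun ω =>
      (K ω * (K ω)ᴴ).det • v - (K ω)ᴴ *ᵥ ((K ω * (K ω)ᴴ).adjugate *ᵥ (K ω *ᵥ v)) with hw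
    have hKw : ∀ ω, K ω *ᵥ w ω = 0 := fun ω => by
      simp only [hw]
      rw [mulVec_sub, mulVec_smul, mulVec_mulVec, mulVec_mulVec, mul_adjugate, smul_mulVec,
        one_mulVec, sub_self]
    have hKv : ∀ ω v, K ω *ᵥ v = F *ᵥ v - jw ω • (v ∘ Sum.inl) := fun ω v => by
      rw [hK, sub_mulVec, smul_mulVec, statePart_mulVec]
    have hcont : Continuous w := by
      have hKc : Continuous K := by
        simp only [hK, jw]
        fun_prop
      simp only [hw]
      fun_prop
    have hw0 : w ω₀ = (K ω₀ * (K ω₀)ᴴ).det • v := by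
      have : K ω₀ *ᵥ v = 0 := by rw [hKv, hv]; exact sub_self _
      simp only [hw]
      rw [this]
      simp
    have hquad : quad (sectorM C D η) (w ω₀) ≤ 0 := by
      have hqc : Continuous fun ω => quad (sectorM C D η) (w ω) := by
        unfold quad
        fun_prop
      refine le_of_tendsto (hqc.continuousAt.tendsto.mono_left
        (nhdsWithin_le_nhds (s := Set.Ioi ω₀))) ?_
      filter_upwards [eventually_charpoly_ne_zero A ω₀, self_mem_nhdsWithin] with ω hω hlt
      have hvw : F *ᵥ w ω = (Complex.I * ω) • (w ω ∘ Sum.inl) := by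
        have := hKw ω
        rw [hKv] at this
        exact sub_eq_zero.1 this
      rw [quad_sectorM_eq h hω hvw]
      have := hfdi ω (fun hf => (hω₀ hf).trans (le_of_lt hlt)) hω (w ω ∘ Sum.inr)
      linarith
    have hd : 0 < Complex.normSq (K ω₀ * (K ω₀)ᴴ).det :=
      Complex.normSq_pos.2 (det_pencil_ne_zero hc (jw ω₀))
    have hsm : quad (sectorM C D η) (w ω₀) =
        Complex.normSq (K ω₀ * (K ω₀)ᴴ).det * quad (sectorM C D η) v := by
      rw [hw0, quad, quad, mulVec_smul, star_smul, smul_dotProduct, dotProduct_smul, smul_eq_mul,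
        smul_eq_mul, ← mul_assoc, Complex.star_def, ← Complex.normSq_eq_conj_mul_self,
        Complex.re_ofReal_mul]
    rw [hsm] at hquad
    by_contra! hneg
    exact absurd (mul_pos hd hneg) (not_lt.2 hquad)
  · rw [quad_sectorM, hv, mulVec_zero, zero_add]
    have := hinf (v ∘ Sum.inr)
    linarith

end FDI

/-! ### Reduction to one real multiplier when `η = 0`. -/

section PositiveReal

variable {n m : ℕ} {G : RationalMatrix m} {A : Matrix (Fin n) (Fin n) ℝ}
  {B : Matrix (Fin n) (Fin m) ℝ} {C : Matrix (Fin m) (Fin n) ℝ} {D : Matrix (Fin m) (Fin m) ℝ}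

lemma posSemidef_map_ofReal {N : Type*} [Fintype N] {M : Matrix N N ℝ} (hM : M.PosSemidef) :
    (toComplexMatrix M).PosSemidef := by
  refine posSemidef_iff_quad.2 ⟨?_, fun x => ?_⟩
  · ext i j
    simpa using congrFun (congrFun hM.1 i) j
  · have e : quad (toComplexMatrix M) x = star (fun i => (x i).re) ⬝ᵥ M *ᵥ (fun i => (x i).re) +
        star (fun i => (x i).im) ⬝ᵥ M *ᵥ fun i => (x i).im := by
      simp only [quad, dotProduct, mulVec, Complex.re_sum, Finset.mul_sum, ← Finset.sum_add_distrib]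
      refine Finset.sum_congr rfl fun i _ => Finset.sum_congr rfl fun j _ => ?_
      simp
    rw [e]
    exact add_nonneg (hM.dotProduct_mulVec_nonneg _) (hM.dotProduct_mulVec_nonneg _)

lemma posSemidef_map_re {N : Type*} [Fintype N] {M : Matrix N N ℂ} (hM : M.PosSemidef) :
    (M.map Complex.re).PosSemidef := by
  refine posSemidef_iff_dotProduct_mulVec.2 ⟨?_, fun x => ?_⟩
  · ext i j
    simpa using congrArg Complex.re (congrFun (congrFun hM.1 i) j)
  · have e : star x ⬝ᵥ M.map Complex.re *ᵥ x = quad M fun i => (x i : ℂ) := by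
      simp only [quad, dotProduct, mulVec, Complex.re_sum, Finset.mul_sum]
      refine Finset.sum_congr rfl fun i _ => Finset.sum_congr rfl fun j _ => ?_
      simp
    rw [e]
    exact (posSemidef_iff_quad.1 hM).2 _

lemma positiveRealLMI_toComplexMatrix (X : Matrix (Fin n) (Fin n) ℝ) (hX : X.IsSymm) :
    toComplexMatrix (-(fromBlocks (Aᵀ * X + X * A) (X * B - Cᵀ) (Bᵀ * X - C) (-D - Dᵀ))) =
      -(kypOp (toComplexMatrix A) (toComplexMatrix B) (toComplexMatrix X) + sectorM C D 0) := by
  have hmul : ∀ {a b c : ℕ} (M : Matrix (Fin a) (Fin b) ℝ) (M' : Matrix (Fin b) (Fin c) ℝ),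
      toComplexMatrix M * toComplexMatrix M' = toComplexMatrix (M * M') := fun M M' =>
    (Matrix.map_mul (f := Complex.ofRealHom)).symm
  rw [kypOp_eq_fromBlocks, sectorM, fromBlocks_add]
  simp only [← toComplexMatrix_transpose, hX.eq, hmul]
  ext i j
  rcases i with i | i <;> rcases j with j | j <;> simp [sub_eq_add_neg]

lemma exists_sectorLMI_of_positiveRealLMI {X : Matrix (Fin n) (Fin n) ℝ}
    (hX : SatisfiesPositiveRealLMI A B C D X) :
    SatisfiesSectorLMI A B C D 0 (toComplexMatrix X) 0 := by
  refine (satisfiesSectorLMI_iff ?_ isHermitian_zero).2 ⟨PosSemidef.zero, ?_⟩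
  · rw [IsHermitian, ← toComplexMatrix_transpose, hX.1.eq]
  · rw [smul_zero, add_zero, ← positiveRealLMI_toComplexMatrix X hX.1]
    exact posSemidef_map_ofReal hX.2

lemma valueAt_conj (ω : ℝ) :
    valueAt G (jw (-ω) : ℂ) = (valueAt G (jw ω : ℂ)).map (starRingEnd ℂ) := by
  have hj : jw (-ω) = starRingEnd ℂ (jw ω) := by simp [jw]
  ext i k
  change Polynomial.aeval (jw (-ω)) (G i k).num / Polynomial.aeval (jw (-ω)) (G i k).denom =
    starRingEnd ℂ (Polynomial.aeval (jw ω) (G i k).num / Polynomial.aeval (jw ω) (G i k).denom)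
  rw [hj, Polynomial.aeval_conj, Polynomial.aeval_conj, map_div₀]

lemma inHalfPlane_zero_conj {M : Matrix (Fin m) (Fin m) ℂ} (hM : InHalfPlane 0 M) :
    InHalfPlane 0 (M.map (starRingEnd ℂ)) := by
  intro u
  have h := hM (star u)
  have e : star u ⬝ᵥ M.map (starRingEnd ℂ) *ᵥ u = star (star (star u) ⬝ᵥ M *ᵥ star u) := by
    simp [dotProduct, mulVec, Finset.mul_sum]
  rw [e]
  simpa using h

/-- At `η = 0` the pair of multipliers can be replaced by one real symmetric matrix. -/
theorem exists_positiveRealLMI (hproper : IsProperRational G) (hmin : IsMinimalRealization G A B C D)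
    {X Y : Matrix (Fin n) (Fin n) ℂ} (hL : SatisfiesSectorLMI A B C D 0 X Y) :
    ∃ X : Matrix (Fin n) (Fin n) ℝ, SatisfiesPositiveRealLMI A B C D X := by
  have hinf : InHalfPlane 0 (toComplexMatrix D) := by
    rw [← valueAt_infty hproper hmin.1]
    exact inHalfPlane_of_lmi hproper hmin.1 hL (Or.inr rfl)
  -- Negative frequencies come from `G(-jω) = conj G(jω)` and the symmetry of the right half plane
  -- under conjugation. The inequality on the whole axis provides a Hermitian `P`.
  obtain ⟨P, ⟨-, hP⟩, hM⟩ := exists_multiplier_of_inHalfPlane (full := True) hmin.1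
    (isControllablePair_of_isMinimalRealization hmin) (fun ω _ hω => by
      rcases le_total 0 ω with h0 | h0
      · exact inHalfPlane_of_lmi_of_charpoly_ne_zero hmin.1 hL h0 hω
      · rw [← neg_neg ω, valueAt_conj]
        refine inHalfPlane_zero_conj
          (inHalfPlane_of_lmi_of_charpoly_ne_zero hmin.1 hL (neg_nonneg.2 h0) fun h => hω ?_)
        have hj : jw (-ω) = starRingEnd ℂ (jw ω) := by simp [jw]
        rwa [hj, Polynomial.aeval_conj, map_eq_zero] at h) hinf
  replace hP : P.IsHermitian := hP trivial
  have hPr : (P.map Complex.re).IsSymm := by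
    ext i j
    simpa using congrArg Complex.re (congrFun (congrFun hP i) j)
  -- All data are real at `η = 0`, so taking entrywise real parts replaces `P` by its real part and
  -- preserves semidefiniteness.
  refine ⟨P.map Complex.re, hPr, ?_⟩
  have h := posSemidef_map_re hM
  rw [kypOp_eq_fromBlocks, sectorM, fromBlocks_add, hP.eq] at h
  convert h using 1
  have hre1 : ∀ {a b c : ℕ} (M : Matrix (Fin a) (Fin b) ℝ) (N : Matrix (Fin b) (Fin c) ℂ) i j,
      ((toComplexMatrix M * N) i j).re = (M * N.map Complex.re) i j := by
    intro a b c M N i j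
    simp [Matrix.mul_apply]
  have hre2 : ∀ {a b c : ℕ} (N : Matrix (Fin a) (Fin b) ℂ) (M : Matrix (Fin b) (Fin c) ℝ) i j,
      ((N * toComplexMatrix M) i j).re = (N.map Complex.re * M) i j := by
    intro a b c N M i j
    simp [Matrix.mul_apply]
  simp only [← toComplexMatrix_transpose]
  ext i j
  rcases i with i | i <;> rcases j with j | j <;> simp [sub_eq_add_neg, hre1, hre2]

end PositiveReal

/-! ### Phases and half planes -/

section Phases

variable {m : ℕ}

/-- The quadratic form of the canonical form. -/
lemma star_dotProduct_canonicalForm (z p q : ℕ) (θ₀ : ℝ) (θ : Fin p → ℝ)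
    (w : Fin z ⊕ (Fin p ⊕ (Fin 2 × Fin q)) → ℂ) :
    star w ⬝ᵥ sectorialCanonicalForm z p q θ₀ θ *ᵥ w =
      ∑ i, Complex.exp (θ i * Complex.I) * Complex.normSq (w (Sum.inr (Sum.inl i))) +
      ∑ l, Complex.exp (θ₀ * Complex.I) * (Complex.normSq (w (Sum.inr (Sum.inr (0, l)))) +
        2 * (star (w (Sum.inr (Sum.inr (0, l)))) * w (Sum.inr (Sum.inr (1, l)))) +
        Complex.normSq (w (Sum.inr (Sum.inr (1, l))))) := by
  simp only [sectorialCanonicalForm, dotProduct, mulVec, Fintype.sum_sum_type,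
    Fintype.sum_prod_type, Fin.sum_univ_two, fromBlocks_apply₁₁, fromBlocks_apply₁₂,
    fromBlocks_apply₂₁, fromBlocks_apply₂₂, blockDiagonal_apply, diagonal_apply, Pi.star_apply,
    Matrix.zero_apply, zero_mul, Finset.sum_const_zero, add_zero, zero_add, mul_zero]
  congr 1
  · refine Finset.sum_congr rfl fun i _ => ?_
    simp [Complex.normSq_eq_conj_mul_self]
    ring
  · rw [← Finset.sum_add_distrib]
    refine Finset.sum_congr rfl fun l _ => ?_
    simp [Complex.normSq_eq_conj_mul_self]
    ring

lemma star_dotProduct_congruence {N : Type*} [Fintype N] (e : Fin m ≃ N) (S : Matrix N N ℂ)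
    (T : Matrix (Fin m) (Fin m) ℂ) (u : Fin m → ℂ) :
    star u ⬝ᵥ (Tᴴ * S.submatrix e e * T) *ᵥ u =
      star ((T *ᵥ u) ∘ e.symm) ⬝ᵥ S *ᵥ ((T *ᵥ u) ∘ e.symm) := by
  rw [star_dotProduct_mul_mulVec, submatrix_mulVec_equiv]
  set y := T *ᵥ u
  rw [dotProduct, dotProduct, ← e.sum_comp]
  simp

lemma exp_neg_mul_exp_re (η θ : ℝ) :
    (Complex.exp (-(η * Complex.I)) * Complex.exp (θ * Complex.I)).re = Real.cos (θ - η) := by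
  rw [← Complex.exp_add, show -(η * Complex.I) + θ * Complex.I = ((θ - η : ℝ) : ℂ) * Complex.I by
    push_cast; ring, Complex.exp_ofReal_mul_I_re]

/-- A diagonal phase contributes `cos (θ i - η) ≥ 0` times a squared modulus. If blocks `E` occur,
both `θ₀ ± π/2` lie in an interval of length `π` centred at `η` modulo `2π`, so `θ₀` is that centre,
and each block contributes `|a + b|²`. -/
lemma inHalfPlane_of_hasPhases {C : Matrix (Fin m) (Fin m) ℂ} {Φ : Multiset ℝ}
    (h : HasPhases C Φ) {η : ℝ} {k : ℤ}
    (hΦ : ∀ θ ∈ Φ, |θ - (η + 2 * Real.pi * k)| ≤ Real.pi / 2) : InHalfPlane η C := by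
  obtain ⟨z, p, q, e, T, θ₀, θ, -, -, rfl, rfl⟩ := h
  intro u
  rw [star_dotProduct_congruence, star_dotProduct_canonicalForm, mul_add, Finset.mul_sum,
    Finset.mul_sum, Complex.add_re, Complex.re_sum, Complex.re_sum]
  refine add_nonneg (Finset.sum_nonneg fun i _ => ?_) (Finset.sum_nonneg fun l _ => ?_)
  · rw [← mul_assoc, Complex.re_mul_ofReal, exp_neg_mul_exp_re]
    refine mul_nonneg ?_ (Complex.normSq_nonneg _)
    have h1 := abs_le.1 (hΦ (θ i) (by simp))
    have h2 : Real.cos (θ i - η) = Real.cos (θ i - (η + 2 * Real.pi * k)) := by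
      rw [← Real.cos_sub_int_mul_two_pi (θ i - η) k]
      congr 1
      ring
    rw [h2]
    exact Real.cos_nonneg_of_mem_Icc ⟨by linarith, by linarith⟩
  · have hq : q ≠ 0 := fun h0 => (h0 ▸ l).elim0
    have h1 := abs_le.1 (hΦ (θ₀ + Real.pi / 2) (by simp [Multiset.mem_replicate, hq]))
    have h2 := abs_le.1 (hΦ (θ₀ - Real.pi / 2) (by simp [Multiset.mem_replicate, hq]))
    have h3 : θ₀ = η + 2 * Real.pi * k := by linarith
    have h4 : Complex.exp (-(η * Complex.I)) * Complex.exp (θ₀ * Complex.I) = 1 := by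
      rw [← Complex.exp_add, Complex.exp_eq_one_iff]
      refine ⟨k, ?_⟩
      rw [h3]
      push_cast
      ring
    rw [← mul_assoc, h4, one_mul]
    generalize ((T *ᵥ u) ∘ e.symm) (Sum.inr (Sum.inr (0, l))) = a
    generalize ((T *ᵥ u) ∘ e.symm) (Sum.inr (Sum.inr (1, l))) = b
    have h5 : ((Complex.normSq a : ℂ) + 2 * (star a * b) + Complex.normSq b).re =
        Complex.normSq (a + b) := by
      simp [Complex.normSq_apply]
      ring
    rw [h5]
    exact Complex.normSq_nonneg _

/-- The numerical range of an `E` block is a half plane with inner normal `e^{jθ₀}`, so it fits in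
the half plane of `η` only when the two directions coincide. -/
lemma cos_nonneg_of_inHalfPlane {z p q : ℕ} {e : Fin m ≃ Fin z ⊕ (Fin p ⊕ (Fin 2 × Fin q))}
    {T : Matrix (Fin m) (Fin m) ℂ} {θ₀ : ℝ} {θ : Fin p → ℝ} (hT : IsUnit T) {η : ℝ}
    (h : InHalfPlane η (Tᴴ * (sectorialCanonicalForm z p q θ₀ θ).submatrix e e * T)) :
    (∀ i, 0 ≤ Real.cos (θ i - η)) ∧ (q ≠ 0 → Real.cos (θ₀ - η) = 1) := by
  have key : ∀ w, 0 ≤ (Complex.exp (-(η * Complex.I)) *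
      (star w ⬝ᵥ sectorialCanonicalForm z p q θ₀ θ *ᵥ w)).re := fun w => by
    have h1 := h (T⁻¹ *ᵥ (w ∘ e))
    rw [star_dotProduct_congruence, mulVec_mulVec,
      mul_nonsing_inv _ ((isUnit_iff_isUnit_det T).1 hT), one_mulVec] at h1
    have h2 : (w ∘ e) ∘ e.symm = w := by ext; simp
    rwa [h2] at h1
  refine ⟨fun i => ?_, fun hq => ?_⟩
  · have h1 := key (Pi.single (Sum.inr (Sum.inl i)) 1)
    rw [star_dotProduct_canonicalForm] at h1
    rw [← exp_neg_mul_exp_re]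
    have h2 : ∀ j : Fin p, Complex.exp (θ j * Complex.I) * (Complex.normSq
        ((Pi.single (Sum.inr (Sum.inl i)) 1 : Fin z ⊕ (Fin p ⊕ (Fin 2 × Fin q)) → ℂ)
          (Sum.inr (Sum.inl j))) : ℂ) = if j = i then Complex.exp (θ j * Complex.I) else 0 := by
      intro j
      by_cases hj : j = i
      · subst hj; simp
      · simp [hj]
    simp only [h2] at h1
    simpa using h1
  · obtain ⟨l⟩ : Nonempty (Fin q) := Fin.pos_iff_nonempty.1 (Nat.pos_of_ne_zero hq)
    have hE : Complex.exp (-(η * Complex.I)) * Complex.exp (θ₀ * Complex.I) =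
        Complex.exp ((θ₀ - η : ℝ) * Complex.I) := by
      rw [← Complex.exp_add]
      congr 1
      push_cast
      ring
    set c := Complex.exp ((θ₀ - η : ℝ) * Complex.I) with hc
    have hcc : c * star c = 1 := by
      rw [hc, star_exp, ← Complex.exp_add, add_neg_cancel, Complex.exp_zero]
    have hn : Complex.normSq c = 1 := by
      have := Complex.mul_conj c
      rw [← Complex.star_def, hcc] at this
      exact_mod_cast this.symm
    -- With `|c| = 1`, the entries `-c` and `1` in block `l` give the rotated form the value `2c -
    -- 2`, whose real part is nonnegative only for `c = 1`.
    let w : Fin z ⊕ (Fin p ⊕ (Fin 2 × Fin q)) → ℂ :=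
      Sum.elim 0 (Sum.elim 0 fun x => if x.2 = l then (if x.1 = 0 then -c else 1) else 0)
    have h1 := key w
    rw [star_dotProduct_canonicalForm, Finset.sum_eq_single l] at h1
    · simp only [w, Sum.elim_inr, Sum.elim_inl, if_true, Pi.zero_apply, one_ne_zero, if_false,
        map_zero, Complex.ofReal_zero, mul_zero, Finset.sum_const_zero, zero_add, Complex.normSq_neg,
        hn, map_one, Complex.ofReal_one, mul_one, star_neg] at h1
      rw [← mul_assoc, hE, mul_add, mul_add, mul_one, mul_left_comm, mul_neg, hcc] at h1
      have h2 : c.re = Real.cos (θ₀ - η) := Complex.exp_ofReal_mul_I_re _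
      simp only [Complex.add_re, h2] at h1
      norm_num at h1
      exact le_antisymm (Real.cos_le_one _) (by linarith)
    · intro j _ hj
      simp [w, hj]
    · simp

/-- Reduce `θ - α` to `t ∈ [0, 2π)`. The conditions become `sin t ≥ 0`, so `t ≤ π`, and `sin (β - α
- t) ≥ 0`, so `t ≤ β - α`. For `α = β` the value `t = π` would survive, hence the strict inequality.
-/
lemma exists_int_of_cos_nonneg {α β θ : ℝ} (hlt : α < β)
    (h1 : 0 ≤ Real.cos (θ - (α + Real.pi / 2))) (h2 : 0 ≤ Real.cos (θ - (β - Real.pi / 2))) :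
    ∃ k : ℤ, α + 2 * Real.pi * k ≤ θ ∧ θ ≤ β + 2 * Real.pi * k := by
  have hpi := Real.pi_pos
  set k : ℤ := ⌊(θ - α) / (2 * Real.pi)⌋ with hk
  set t := θ - α - 2 * Real.pi * k with ht
  have ht0 : 0 ≤ t := by
    have := Int.floor_le ((θ - α) / (2 * Real.pi))
    rw [← hk, le_div_iff₀ (by positivity)] at this
    linarith
  have ht1 : t < 2 * Real.pi := by
    have := Int.lt_floor_add_one ((θ - α) / (2 * Real.pi))
    rw [← hk, div_lt_iff₀ (by positivity)] at this
    linarith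
  have hs1 : 0 ≤ Real.sin t := by
    have e : Real.cos (θ - (α + Real.pi / 2)) = Real.sin t := by
      rw [show θ - (α + Real.pi / 2) = (t + k * (2 * Real.pi)) - Real.pi / 2 by rw [ht]; ring,
        Real.cos_sub_pi_div_two, Real.sin_add_int_mul_two_pi]
    rwa [← e]
  have hs2 : 0 ≤ Real.sin ((β - α) - t) := by
    have e : Real.cos (θ - (β - Real.pi / 2)) = Real.sin ((β - α) - t) := by
      rw [← Real.cos_pi_div_two_sub, ← Real.cos_sub_int_mul_two_pi _ k]
      congr 1
      rw [ht]
      ring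
    rwa [← e]
  have ht2 : t ≤ Real.pi := by
    by_contra! hgt
    have : Real.sin (t - Real.pi) > 0 := Real.sin_pos_of_pos_of_lt_pi (by linarith) (by linarith)
    rw [Real.sin_sub_pi] at this
    linarith
  have ht3 : t ≤ β - α := by
    by_contra! hgt
    have := Real.sin_neg_of_neg_of_neg_pi_lt (x := (β - α) - t) (by linarith) (by linarith)
    linarith
  exact ⟨k, by linarith, by linarith⟩

/-- The phases of a matrix with numerical range in the sector `[α, β]` lie in `[α, β]` modulo `2π`. -/
lemma exists_int_of_mem_phases {C : Matrix (Fin m) (Fin m) ℂ} {Φ : Multiset ℝ}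
    (h : HasPhases C Φ) {α β : ℝ} (hlt : α < β)
    (h1 : InHalfPlane (α + Real.pi / 2) C) (h2 : InHalfPlane (β - Real.pi / 2) C) {θ : ℝ}
    (hθ : θ ∈ Φ) : ∃ k : ℤ, α + 2 * Real.pi * k ≤ θ ∧ θ ≤ β + 2 * Real.pi * k := by
  obtain ⟨z, p, q, e, T, θ₀, θ', hT, -, rfl, rfl⟩ := h
  obtain ⟨ha, ha'⟩ := cos_nonneg_of_inHalfPlane hT h1
  obtain ⟨hb, hb'⟩ := cos_nonneg_of_inHalfPlane hT h2
  have hquarter : ∀ x : ℝ, Real.cos x = 1 →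
      Real.cos (x + Real.pi / 2) = 0 ∧ Real.cos (x - Real.pi / 2) = 0 := fun x hx => by
    have : Real.sin x = 0 := by
      have := Real.sin_sq_add_cos_sq x
      rw [hx] at this
      nlinarith
    rw [Real.cos_add_pi_div_two, Real.cos_sub_pi_div_two, this]
    simp
  refine exists_int_of_cos_nonneg hlt ?_ ?_
  all_goals
    simp only [Multiset.mem_add, Multiset.mem_map, Multiset.mem_replicate] at hθ
    rcases hθ with (⟨i, -, rfl⟩ | ⟨hq, rfl⟩) | ⟨hq, rfl⟩
  · exact ha i
  · rw [add_sub_right_comm, (hquarter _ (ha' hq)).1]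
  · rw [sub_right_comm, (hquarter _ (ha' hq)).2]
  · exact hb i
  · rw [add_sub_right_comm, (hquarter _ (hb' hq)).1]
  · rw [sub_right_comm, (hquarter _ (hb' hq)).2]

/-- If all phases are `α` modulo `π` and the numerical range lies in the half plane above the line at
angle `α`, then the matrix is a rotated Hermitian matrix. -/
lemma isHermitian_of_phases {C : Matrix (Fin m) (Fin m) ℂ} {Φ : Multiset ℝ} (h : HasPhases C Φ)
    {α : ℝ} {k : ℤ} (h1 : InHalfPlane (α + Real.pi / 2) C)
    (hΦ : ∀ θ ∈ Φ, θ = α + Real.pi + 2 * Real.pi * k ∨ θ = α + 2 * Real.pi + 2 * Real.pi * k) :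
    (Complex.exp (-(α * Complex.I)) • C).IsHermitian := by
  obtain ⟨z, p, q, e, T, θ₀, θ, hT, -, rfl, rfl⟩ := h
  obtain ⟨-, hq1⟩ := cos_nonneg_of_inHalfPlane hT h1
  have hpi := Real.pi_pos
  -- A block `E` would have its phases `θ₀ ± π/2` at the two allowed values, forcing `θ₀ = α + 3π/2`
  -- modulo `2π`, the direction opposite to the normal of the half plane.
  have hq : q = 0 := by
    by_contra hq
    have h2 := hΦ (θ₀ + Real.pi / 2) (by simp [Multiset.mem_replicate, hq])
    have h3 := hΦ (θ₀ - Real.pi / 2) (by simp [Multiset.mem_replicate, hq])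
    have h4 : θ₀ = α + Real.pi + Real.pi / 2 + 2 * Real.pi * k := by
      rcases h2 with h2 | h2 <;> rcases h3 with h3 | h3 <;> linarith
    have h5 := hq1 hq
    rw [h4, show α + Real.pi + Real.pi / 2 + 2 * Real.pi * k - (α + Real.pi / 2) =
      Real.pi + k * (2 * Real.pi) by ring, Real.cos_add_int_mul_two_pi, Real.cos_pi] at h5
    norm_num at h5
  subst hq
  have hθ : ∀ i, Complex.exp (-(α * Complex.I)) * Complex.exp (θ i * Complex.I) = -1 ∨
      Complex.exp (-(α * Complex.I)) * Complex.exp (θ i * Complex.I) = 1 := fun i => by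
    rw [← Complex.exp_add]
    refine (hΦ (θ i) (by simp)).imp (fun hi => ?_) (fun hi => ?_)
    · rw [show -(α * Complex.I) + θ i * Complex.I =
        Real.pi * Complex.I + k * (2 * Real.pi * Complex.I) by rw [hi]; push_cast; ring,
        Complex.exp_add, Complex.exp_pi_mul_I, Complex.exp_int_mul_two_pi_mul_I, mul_one]
    · rw [Complex.exp_eq_one_iff]
      refine ⟨k + 1, ?_⟩
      rw [hi]
      push_cast
      ring
  rw [← Matrix.smul_mul, ← Matrix.mul_smul]
  refine isHermitian_conjTranspose_mul_mul T ?_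
  have hS : (Complex.exp (-(α * Complex.I)) • sectorialCanonicalForm z p 0 θ₀ θ).IsHermitian := by
    rw [sectorialCanonicalForm, fromBlocks_smul, fromBlocks_smul, smul_zero, smul_zero, smul_zero]
    refine isHermitian_zero.fromBlocks (by simp) (IsHermitian.fromBlocks ?_ (by simp) ?_)
    · rw [← diagonal_smul]
      refine isHermitian_diagonal_of_self_adjoint _ (funext fun i => ?_)
      rcases hθ i with hi | hi <;> simp [hi]
    · ext i
      exact i.2.elim0
  exact hS.submatrix e

end Phases

/-! ### The sector of a system -/

section Sector

variable {m : ℕ} {G : RationalMatrix m} (φ : PhaseResponse G)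

lemma lower_le {s : OnePoint ℂ} (hs : s ∈ nonnegFrequencies G) {θ : ℝ} (hθ : θ ∈ φ.phases s) :
    φ.lower ≤ (θ : EReal) :=
  (iInf₂_le s hs).trans (Multiset.inf_le (Multiset.mem_map_of_mem _ hθ))

lemma le_upper {s : OnePoint ℂ} (hs : s ∈ nonnegFrequencies G) {θ : ℝ} (hθ : θ ∈ φ.phases s) :
    (θ : EReal) ≤ φ.upper :=
  (Multiset.le_sup (Multiset.mem_map_of_mem _ hθ)).trans
    (le_iSup₂ (f := fun s (_ : s ∈ nonnegFrequencies G) => maxPhase (φ.phases s)) s hs)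

lemma mem_sector {s : OnePoint ℂ} (hs : s ∈ nonnegFrequencies G) {θ : ℝ}
    (hθ : θ ∈ φ.phases s) : θ ∈ φ.sector :=
  ⟨lower_le φ hs hθ, le_upper φ hs hθ⟩

lemma sector_subset_Icc {a b : ℝ}
    (h : ∀ s ∈ nonnegFrequencies G, ∀ θ ∈ φ.phases s, a ≤ θ ∧ θ ≤ b) : φ.sector ⊆ Set.Icc a b := by
  rintro x ⟨hx1, hx2⟩
  have h1 : (a : EReal) ≤ φ.lower := by
    refine le_iInf₂ fun s hs => Multiset.le_inf.2 fun y hy => ?_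
    obtain ⟨θ, hθ, rfl⟩ := Multiset.mem_map.1 hy
    exact EReal.coe_le_coe_iff.2 (h s hs θ hθ).1
  have h2 : φ.upper ≤ (b : EReal) := by
    refine iSup₂_le fun s hs => Multiset.sup_le.2 fun y hy => ?_
    obtain ⟨θ, hθ, rfl⟩ := Multiset.mem_map.1 hy
    exact EReal.coe_le_coe_iff.2 (h s hs θ hθ).2
  exact ⟨EReal.coe_le_coe_iff.1 (h1.trans hx1), EReal.coe_le_coe_iff.1 (hx2.trans h2)⟩

lemma inHalfPlane_of_sectorSubset {α β : ℝ} (hαβ : β - α ≤ Real.pi) (h : φ.SectorSubset α β)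
    {s : OnePoint ℂ} (hs : s ∈ nonnegFrequencies G) :
    InHalfPlane (α + Real.pi / 2) (valueAt G s) ∧ InHalfPlane (β - Real.pi / 2) (valueAt G s) := by
  obtain ⟨k, hk⟩ := h
  constructor
  all_goals
    refine inHalfPlane_of_hasPhases (φ.hasPhases s hs) (k := k) fun θ hθ => ?_
    have h1 := hk (mem_sector φ hs hθ)
    rw [abs_le]
    constructor <;> linarith [h1.1, h1.2]

/-- If `G(jω)` has its numerical range in the sector `[α, β]` at all frequencies, then, the degenerate
case excepted, the sector of `G` is contained in `[α, β]` modulo `2π`. -/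
theorem sectorSubset_of_inHalfPlane (hsect : φ.IsSemiSectorialSystem) {α β : ℝ} (hlt : α < β)
    (hαβ : β - α ≤ Real.pi) (hnd : ¬ (β - α = Real.pi ∧ φ.IsDegenerate α))
    (h1 : ∀ s ∈ nonnegFrequencies G, InHalfPlane (α + Real.pi / 2) (valueAt G s))
    (h2 : ∀ s ∈ nonnegFrequencies G, InHalfPlane (β - Real.pi / 2) (valueAt G s)) :
    φ.SectorSubset α β := by
  have hpi := Real.pi_pos
  obtain ⟨a, b, hab, hsub⟩ := hsect
  have hint : ∀ s ∈ nonnegFrequencies G, ∀ θ ∈ φ.phases s,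
      ∃ k : ℤ, α + 2 * Real.pi * k ≤ θ ∧ θ ≤ β + 2 * Real.pi * k := fun s hs θ hθ =>
    exists_int_of_mem_phases (φ.hasPhases s hs) hlt (h1 s hs) (h2 s hs) hθ
  have hmem : ∀ s ∈ nonnegFrequencies G, ∀ θ ∈ φ.phases s, a ≤ θ ∧ θ ≤ b := fun s hs θ hθ =>
    hsub (mem_sector φ hs hθ)
  -- If `k < k'`, then `θ' - θ ≥ 2π - (β - α) ≥ π`, whereas `θ' - θ ≤ b - a ≤ π`. Equality
  -- throughout gives `β = α + π`, `a = θ` and `b = θ'`, and every phase must be an end point of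
  -- `[a, b]`: exactly the excluded case.
  have hle : ∀ s ∈ nonnegFrequencies G, ∀ θ ∈ φ.phases s, ∀ s' ∈ nonnegFrequencies G,
      ∀ θ' ∈ φ.phases s', ∀ k k' : ℤ, θ ≤ β + 2 * Real.pi * k → α + 2 * Real.pi * k' ≤ θ' →
      k' ≤ k := by
    intro s hs θ hθ s' hs' θ' hθ' k k' hk hk'
    by_contra! hkk
    have hkk' : (k : ℝ) + 1 ≤ k' := by exact_mod_cast hkk
    have hm : 2 * Real.pi * (k + 1) ≤ 2 * Real.pi * k' := by gcongr
    have ha := (hmem s hs θ hθ).1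
    have hb := (hmem s' hs' θ' hθ').2
    have hβ : β = α + Real.pi := by linarith
    have hθe : θ = α + Real.pi + 2 * Real.pi * k := by linarith
    have hθe' : θ' = α + 2 * Real.pi + 2 * Real.pi * k := by linarith
    have hae : a = θ := by linarith
    have hbe : b = θ' := by linarith
    refine hnd ⟨by linarith, fun t ht => ?_, k, ?_⟩
    · refine isHermitian_of_phases (φ.hasPhases t ht) (k := k) (h1 t ht) fun x hx => ?_
      obtain ⟨l, hl1, hl2⟩ := hint t ht x hx
      have hx1 := (hmem t ht x hx).1
      have hx2 := (hmem t ht x hx).2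
      rcases le_or_gt l k with hlk | hlk
      · have : (l : ℝ) ≤ k := by exact_mod_cast hlk
        have : 2 * Real.pi * l ≤ 2 * Real.pi * k := by gcongr
        left
        linarith
      · have : (k : ℝ) + 1 ≤ l := by exact_mod_cast hlk
        have : 2 * Real.pi * (k + 1) ≤ 2 * Real.pi * l := by gcongr
        right
        linarith
    · rw [← hθe, ← hθe']
      refine Set.Subset.antisymm (by rwa [hae, hbe] at hsub) fun x hx => ⟨?_, ?_⟩
      · exact (lower_le φ hs hθ).trans (EReal.coe_le_coe_iff.2 hx.1)
      · exact (EReal.coe_le_coe_iff.2 hx.2).trans (le_upper φ hs' hθ')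
  by_cases hne : ∃ s ∈ nonnegFrequencies G, ∃ θ, θ ∈ φ.phases s
  · obtain ⟨s, hs, θ, hθ⟩ := hne
    obtain ⟨k, hk1, hk2⟩ := hint s hs θ hθ
    refine ⟨k, sector_subset_Icc φ fun s' hs' θ' hθ' => ?_⟩
    obtain ⟨k', hk1', hk2'⟩ := hint s' hs' θ' hθ'
    have : k' = k := le_antisymm (hle s hs θ hθ s' hs' θ' hθ' k k' hk2 hk1')
      (hle s' hs' θ' hθ' s hs θ hθ k' k hk2' hk1)
    rw [← this]
    exact ⟨hk1', hk2'⟩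
  -- Without any phases the sector is empty, the infimum being `+∞` and the supremum `-∞`, so every
  -- `k` works.
  · exact ⟨0, sector_subset_Icc φ fun s hs θ hθ => (hne ⟨s, hs, θ, hθ⟩).elim⟩

end Sector

end SectoredReal

/-! ### Assembly of the three equivalences and implications. -/

theorem mainTheorem5 {m n : ℕ} (G : RationalMatrix m)
    (hproper : IsProperRational G) (hstable : IsSemiStable G)
    (hfreq : IsFrequencywiseSemiSectorial G)
    (φ : PhaseResponse G) (hsect : φ.IsSemiSectorialSystem)
    (A : Matrix (Fin n) (Fin n) ℝ) (B : Matrix (Fin n) (Fin m) ℝ)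
    (C : Matrix (Fin m) (Fin n) ℝ) (D : Matrix (Fin m) (Fin m) ℝ)
    (hmin : IsMinimalRealization G A B C D)
    (α β : ℝ) (hαβ : β - α ≤ Real.pi) :
    (α < β → ¬ (β - α = Real.pi ∧ φ.IsDegenerate α) →
      (φ.SectorSubset α β ↔
        ∃ X₁ Y₁ X₂ Y₂ : Matrix (Fin n) (Fin n) ℂ,
          SatisfiesSectorLMI A B C D (α + Real.pi / 2) X₁ Y₁ ∧
          SatisfiesSectorLMI A B C D (β - Real.pi / 2) X₂ Y₂)) ∧
    (φ.SectorSubset α β →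
        ∃ X₁ Y₁ X₂ Y₂ : Matrix (Fin n) (Fin n) ℂ,
          SatisfiesSectorLMI A B C D (α + Real.pi / 2) X₁ Y₁ ∧
          SatisfiesSectorLMI A B C D (β - Real.pi / 2) X₂ Y₂) ∧
    (α = -(Real.pi / 2) → β = Real.pi / 2 →
      ((∃ X₁ Y₁ X₂ Y₂ : Matrix (Fin n) (Fin n) ℂ,
          SatisfiesSectorLMI A B C D (α + Real.pi / 2) X₁ Y₁ ∧
          SatisfiesSectorLMI A B C D (β - Real.pi / 2) X₂ Y₂) ↔
        ∃ X : Matrix (Fin n) (Fin n) ℝ, SatisfiesPositiveRealLMI A B C D X)) := by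
  have hlmi : φ.SectorSubset α β → ∃ X₁ Y₁ X₂ Y₂ : Matrix (Fin n) (Fin n) ℂ,
      SatisfiesSectorLMI A B C D (α + Real.pi / 2) X₁ Y₁ ∧
      SatisfiesSectorLMI A B C D (β - Real.pi / 2) X₂ Y₂ := by
    intro h
    have hhalf : ∀ η : ℝ, (∀ s ∈ nonnegFrequencies G, SectoredReal.InHalfPlane η (valueAt G s)) →
        ∃ X Y, SatisfiesSectorLMI A B C D η X Y := fun η hη => by
      obtain ⟨P, hP, hM⟩ := SectoredReal.exists_multiplier_of_inHalfPlane (full := False) hmin.1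
        (SectoredReal.isControllablePair_of_isMinimalRealization hmin) (fun ω h0 hω => hη _
          (Or.inl ⟨ω, h0 not_false, SectoredReal.not_isPole_of_charpoly_ne_zero hmin.1 hω, rfl⟩))
        (by
          rw [← SectoredReal.valueAt_infty hproper hmin.1]
          exact hη _ (Or.inr rfl))
      exact SectoredReal.exists_satisfiesSectorLMI_of_multiplier hP hM
    obtain ⟨X₁, Y₁, h1⟩ := hhalf _ fun s hs =>
      (SectoredReal.inHalfPlane_of_sectorSubset φ hαβ h hs).1
    obtain ⟨X₂, Y₂, h2⟩ := hhalf _ fun s hs =>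
      (SectoredReal.inHalfPlane_of_sectorSubset φ hαβ h hs).2
    exact ⟨X₁, Y₁, X₂, Y₂, h1, h2⟩
  refine ⟨fun hlt hnd => ⟨hlmi, ?_⟩, hlmi, ?_⟩
  · rintro ⟨X₁, Y₁, X₂, Y₂, h1, h2⟩
    exact SectoredReal.sectorSubset_of_inHalfPlane φ hsect hlt hαβ hnd
      (fun s hs => SectoredReal.inHalfPlane_of_lmi hproper hmin.1 h1 hs)
      (fun s hs => SectoredReal.inHalfPlane_of_lmi hproper hmin.1 h2 hs)
  · rintro rfl rfl
    rw [neg_add_cancel, sub_self]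
    constructor
    · rintro ⟨X₁, Y₁, -, -, h1, -⟩
      exact SectoredReal.exists_positiveRealLMI hproper hmin h1
    · rintro ⟨X, hX⟩
      have := SectoredReal.exists_sectorLMI_of_positiveRealLMI hX
      exact ⟨_, _, _, _, this, this⟩
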